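/- There exists a smooth, measured, integrally Dehn-twisted plug with exactly two closed leaves. It may be taken with its support embedded in $\mathbb{R}^3$. In detail, there are a compact set $P\subset\mathbb{R}^3$, homeomorphic to the solid torus $S^1\times D^2$ and locally carried to the orthant $[0,\infty)^3$ by diffeomorphisms between open subsets of $\mathbb{R}^3$, and a smooth nowhere vanishing vector field $V$ on $P$, with the following properties. A leaf is a maximal trajectory of $V$ in $P$. 1. (Flow bordism) Every point of $\partial P$ is of one of three kinds: a point of transverse boundary (on one face only, with $V$ transverse to it), a point of parallel boundary (on one face only, with $V$ tangent to that face near the point), or a corner on exactly two faces, one transverse and one parallel to $V$. Every leaf in the parallel boundary is finite, i.e. a compact arc. Let $F_-$ and $F_+$ be the closures of the transverse boundary where $V$ points into $P$ and out of $P$, respectively; every finite leaf runs from $F_-$ to $F_+$. 2. (Measured) $V$ preserves a smooth volume form on $P$, i.e. $\operatorname{div}(\rho V)=0$ for some smooth function $\rho>0$ on $P$. 3. (Plug) Some leaf has an endpoint in $F_-$ and is infinite. With the annulus $F=S^1\times I$, $I=[0,1]$, there are diffeomorphisms $\alpha_\pm:F\to F_\pm$ such that if $\alpha_-(q)$ and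 $\alpha_+(p)$ are the endpoints of a leaf, then $p=q$. 4. (Integrally Dehn-twisted) There is an attaching map, i.e. a diffeomorphism $\alpha$ from a neighborhood of $\partial(F\times I)$ in $F\times I$ to a neighborhood of $\partial P$ in $P$ which takes the oriented foliation by the segments $\{p\}\times I$ to the foliation parallel to $V$ and satisfies $\alpha(p,0)=\alpha_-(p)$ and $\alpha(p,1)=\alpha_+(p)$ for $p\in F$, such that, with $m=\{p_0\}\times\partial(I\times I)$ and $l=S^1\times\{0\}\times\{0\}$ on $\partial(F\times I)=\partial(S^1\times I\times I)$, the image under $\alpha$ of a simple closed curve in the class $m+l$ or in the class $m-l$ is a meridian of $P$, i.e. bounds an embedded disk in $P$. 5. (Closed leaves) $V$ has exactly two closed leaves, i.e. images of periodic trajectories, in $P$. -/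

import Mathlib

open scoped ContDiff

noncomputable section

namespace DehnPlug

/-- Euclidean 3-space. -/
abbrev E3 := EuclideanSpace ℝ (Fin 3)

/-- The Euclidean plane. -/
abbrev E2 := EuclideanSpace ℝ (Fin 2)

/-! ### Orthant domains: codimension-zero smooth orthant manifolds in 3-space -/

/-- The closed orthant of points with non-negative coordinates. -/
def orthant : Set E3 := {x | ∀ i, 0 ≤ x i}

/-- A smooth chart of 3-space (a diffeomorphism between open sets) which carries `P` to the
orthant. -/
structure IsOrthantChart (P : Set E3) (φ : OpenPartialHomeomorph E3 E3) : Prop where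
  smooth : ContDiffOn ℝ ∞ φ φ.source
  smooth_symm : ContDiffOn ℝ ∞ φ.symm φ.target
  isImage : φ.IsImage P orthant

/-- `P ⊆ ℝ³` is a smooth 3-dimensional orthant manifold: near each of its points it is carried to
an open piece of the orthant by a local diffeomorphism of `ℝ³`. -/
def IsOrthantDomain (P : Set E3) : Prop :=
  ∀ p ∈ P, ∃ φ : OpenPartialHomeomorph E3 E3, IsOrthantChart P φ ∧ p ∈ φ.source

/-! ### Boundary behaviour of the foliation parallel to a vector field -/

/-- `p` is a point of transverse boundary at which `V` points into `P`. -/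
def IsTransverseIn (V : E3 → E3) (P : Set E3) (p : E3) : Prop :=
  ∃ φ : OpenPartialHomeomorph E3 E3, IsOrthantChart P φ ∧ p ∈ φ.source ∧
    ∃ i, φ p i = 0 ∧ (∀ j, j ≠ i → 0 < φ p j) ∧ 0 < (fderiv ℝ φ p (V p)) i

/-- `p` is a point of transverse boundary at which `V` points out of `P`. -/
def IsTransverseOut (V : E3 → E3) (P : Set E3) (p : E3) : Prop :=
  ∃ φ : OpenPartialHomeomorph E3 E3, IsOrthantChart P φ ∧ p ∈ φ.source ∧
    ∃ i, φ p i = 0 ∧ (∀ j, j ≠ i → 0 < φ p j) ∧ (fderiv ℝ φ p (V p)) i < 0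

/-- `p` is a point of parallel boundary: it lies on one face only, and `V` is tangent to that face
near `p`. -/
def IsParallel (V : E3 → E3) (P : Set E3) (p : E3) : Prop :=
  ∃ φ : OpenPartialHomeomorph E3 E3, IsOrthantChart P φ ∧ p ∈ φ.source ∧
    ∃ i, φ p i = 0 ∧ (∀ j, j ≠ i → 0 < φ p j) ∧
      ∀ q ∈ φ.source, q ∈ P → φ q i = 0 → (fderiv ℝ φ q (V q)) i = 0

/-- `p` is a corner which separates transverse boundary from parallel boundary: it lies on exactly
two faces; near `p`, the vector field `V` is tangent to the face `i` and transverse to the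
face `j`. -/
def IsCornerSeparation (V : E3 → E3) (P : Set E3) (p : E3) : Prop :=
  ∃ φ : OpenPartialHomeomorph E3 E3, IsOrthantChart P φ ∧ p ∈ φ.source ∧
    ∃ i j, i ≠ j ∧ φ p i = 0 ∧ φ p j = 0 ∧ (∀ k, k ≠ i → k ≠ j → 0 < φ p k) ∧
      (∀ q ∈ φ.source, q ∈ P → φ q i = 0 → (fderiv ℝ φ q (V q)) i = 0) ∧
      (fderiv ℝ φ p (V p)) j ≠ 0

/-- The entry region `F₋`. -/
def entryRegion (V : E3 → E3) (P : Set E3) : Set E3 := closure {p | IsTransverseIn V P p}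

/-- The exit region `F₊`. -/
def exitRegion (V : E3 → E3) (P : Set E3) : Set E3 := closure {p | IsTransverseOut V P p}

/-! ### Leaves -/

/-- `γ`, restricted to the set of times `J`, is a trajectory of `V` that stays in `P`. -/
def IsTrajectoryOn (V : E3 → E3) (P : Set E3) (γ : ℝ → E3) (J : Set ℝ) : Prop :=
  ∀ t ∈ J, γ t ∈ P ∧ HasDerivWithinAt γ (V (γ t)) J t

/-- The leaf through `p` is finite: a compact arc that runs from `F₋` to `F₊`. -/
def IsOnFiniteLeaf (V : E3 → E3) (P : Set E3) (p : E3) : Prop :=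
  ∃ (s t : ℝ) (γ : ℝ → E3), s < t ∧ 0 ∈ Set.Icc s t ∧ IsTrajectoryOn V P γ (Set.Icc s t) ∧
    γ 0 = p ∧ γ s ∈ entryRegion V P ∧ γ t ∈ exitRegion V P

/-- A leaf begins at `p` and ends at `q`. (Used for `p` in `F₋` and `q` in `F₊`.) -/
def LeafConnects (V : E3 → E3) (P : Set E3) (p q : E3) : Prop :=
  ∃ (t : ℝ) (γ : ℝ → E3), 0 < t ∧ IsTrajectoryOn V P γ (Set.Icc 0 t) ∧ γ 0 = p ∧ γ t = q

/-- There is an infinite leaf with an endpoint in `F₋`. -/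
def HasInfiniteLeafFromEntry (V : E3 → E3) (P : Set E3) : Prop :=
  ∃ γ : ℝ → E3, γ 0 ∈ entryRegion V P ∧ IsTrajectoryOn V P γ (Set.Ici 0)

/-- `L` is a closed leaf, that is, the image of a periodic trajectory. -/
def IsClosedLeaf (V : E3 → E3) (P : Set E3) (L : Set E3) : Prop :=
  ∃ (γ : ℝ → E3) (T : ℝ), 0 < T ∧ IsTrajectoryOn V P γ Set.univ ∧ Function.Periodic γ T ∧
    L = Set.range γ

/-! ### Flow bordisms, measures, plugs -/

/-- The oriented foliation of `P` parallel to the smooth non-vanishing vector field `V` is a flow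
bordism. -/
structure IsFlowBordism (V : E3 → E3) (P : Set E3) : Prop where
  compact : IsCompact P
  orthantDomain : IsOrthantDomain P
  smooth : ContDiffOn ℝ ∞ V P
  ne_zero : ∀ p ∈ P, V p ≠ 0
  boundary : ∀ p ∈ frontier P, IsTransverseIn V P p ∨ IsTransverseOut V P p ∨
    IsParallel V P p ∨ IsCornerSeparation V P p
  finite_of_parallel : ∀ p, IsParallel V P p → IsOnFiniteLeaf V P p

/-- The divergence at `p` of a vector field on `P`. -/
def divWithin (W : E3 → E3) (P : Set E3) (p : E3) : ℝ :=
  ∑ i, (fderivWithin ℝ W P p (EuclideanSpace.single i 1)) i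

/-- The foliation parallel to `V` is measured: `V` preserves a smooth volume form
`ρ dx ∧ dy ∧ dz` on `P`. Equivalently, the flux form, which is the contraction of that volume form
with `V`, is closed; its exterior derivative is `div (ρ V) dx ∧ dy ∧ dz`. -/
def IsMeasured (V : E3 → E3) (P : Set E3) : Prop :=
  ∃ ρ : E3 → ℝ, ContDiffOn ℝ ∞ ρ P ∧ (∀ p ∈ P, 0 < ρ p) ∧
    ∀ p ∈ P, divWithin (fun x => ρ x • V x) P p = 0

/-- `a` and `b` are diffeomorphisms from the compact planar surface `B` to the entry and the exit
region, and any leaf that ends at `b x` and begins at `a y` has `x = y`. -/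
structure HasMatchedEnds (V : E3 → E3) (P : Set E3) (B : Set E2) (a b : E2 → E3) : Prop where
  smooth_entry : ContDiffOn ℝ ∞ a B
  smooth_exit : ContDiffOn ℝ ∞ b B
  immersion_entry : ∀ x ∈ B, Function.Injective (fderivWithin ℝ a B x)
  immersion_exit : ∀ x ∈ B, Function.Injective (fderivWithin ℝ b B x)
  bij_entry : Set.BijOn a B (entryRegion V P)
  bij_exit : Set.BijOn b B (exitRegion V P)
  matched : ∀ x ∈ B, ∀ y ∈ B, LeafConnects V P (a y) (b x) → x = y

/-- The foliation of `P` parallel to `V` is a smooth plug with base `B`, identified with the entry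
and the exit region by `a` and `b`. -/
structure IsPlug (V : E3 → E3) (P : Set E3) (B : Set E2) (a b : E2 → E3) : Prop where
  flowBordism : IsFlowBordism V P
  infiniteLeaf : HasInfiniteLeafFromEntry V P
  matchedEnds : HasMatchedEnds V P B a b

/-! ### Attaching maps and Dehn twists for plugs over an annulus -/

/-- The annulus `F = S¹ × I`. -/
def annulus : Set E2 := {x | 1 ≤ ‖x‖ ∧ ‖x‖ ≤ 2}

/-- The point of `ℝ³` over `x` at height `z`. -/
def lift (x : E2) (z : ℝ) : E3 := !₂[x 0, x 1, z]

/-- The thickened base `F × I`, foliated by its vertical segments. -/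
def thickAnnulus : Set E3 := {y | ∃ x ∈ annulus, ∃ z ∈ Set.Icc (0 : ℝ) 1, y = lift x z}

/-- `α` is an attaching map: a leaf-preserving diffeomorphism between a neighborhood of the
boundary of `F × I` and a neighborhood of the boundary of `P`, which is `a` on `F × {0}` and `b`
on `F × {1}`. -/
structure IsAttachingMap (V : E3 → E3) (P : Set E3) (a b : E2 → E3) (α : PartialEquiv E3 E3) :
    Prop where
  source_eq : ∃ N, IsOpen N ∧ frontier thickAnnulus ⊆ N ∧ α.source = thickAnnulus ∩ N
  target_eq : ∃ N, IsOpen N ∧ frontier P ⊆ N ∧ α.target = P ∩ N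
  smooth : ContDiffOn ℝ ∞ α α.source
  smooth_symm : ContDiffOn ℝ ∞ α.symm α.target
  leaf : ∀ x ∈ α.source, ∃ c : ℝ, 0 < c ∧
    fderivWithin ℝ α α.source x (EuclideanSpace.single 2 1) = c • V (α x)
  bottom : ∀ x ∈ annulus, α (lift x 0) = a x
  top : ∀ x ∈ annulus, α (lift x 1) = b x

/-- A simple closed curve in the class `m + k l` on the boundary of `F × I`, with period `2π`. Here
`m = {point} × ∂(I × I)` and `l = S¹ × {0} × {0}`: while the curve goes once around the square
`1 ≤ r ≤ 2`, `0 ≤ z ≤ 1`, its polar angle grows by `2 π k`. -/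
def slopeCurve (k : ℤ) (t : ℝ) : E3 :=
  let N := max |Real.cos t| |Real.sin t|
  let r := 3 / 2 + Real.cos t / (2 * N)
  let z := 1 / 2 + Real.sin t / (2 * N)
  !₂[r * Real.cos (k * t), r * Real.sin (k * t), z]

/-- The closed curve `c` of period `2π` bounds an embedded disk in `P` whose interior lies in the
interior of `P`. -/
def BoundsDisk (P : Set E3) (c : ℝ → E3) : Prop :=
  ∃ D : E2 → E3, ContinuousOn D (Metric.closedBall 0 1) ∧ Set.InjOn D (Metric.closedBall 0 1) ∧
    Set.MapsTo D (Metric.ball 0 1) (interior P) ∧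
    ∀ t : ℝ, D !₂[Real.cos t, Real.sin t] = c t

/-- `P` is homeomorphic to the solid torus `S¹ × D²`. -/
def IsSolidTorus (P : Set E3) : Prop :=
  Nonempty (P ≃ₜ Circle × Metric.closedBall (0 : E2) 1)

/-- A plug with base the annulus, identified with the entry and the exit region by `a` and `b`, is
integrally Dehn-twisted: its support is a solid torus, in which the image of `m + l` or of `m - l`
under an attaching map is a meridian, that is, bounds a disk. (This image is an essential curve of
`∂P`, because the attaching map restricts to a homeomorphism of the boundary tori.) -/
def IsIntegrallyDehnTwisted (V : E3 → E3) (P : Set E3) (a b : E2 → E3) : Prop :=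
  IsSolidTorus P ∧ ∃ α : PartialEquiv E3 E3, IsAttachingMap V P a b α ∧
    (BoundsDisk P (fun t => α (slopeCurve 1 t)) ∨ BoundsDisk P (fun t => α (slopeCurve (-1) t)))

end DehnPlug

end

/-! Take as coordinates x = ν − 3/2, where ν is the squared distance from the axis, the height z and
the polar angle θ. Lebesgue measure is ½ dx dz dθ, so a field with area-preserving (x, z)-part and
with angular speed depending on (x, z) only preserves volume (`divergence_vfield`). The body is a
circle times the square |x| ≤ 1/2, 0 ≤ z ≤ 1.

The planar part has the Hamiltonian x · `damp`. The factor `damp` is 1 outside two discs of radius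
1/8 about A = (0, 1/2) and B = (0, 3/4), vanishes quadratically at A and B, and does not decrease
with |x|. Hence the planar field is the vertical unit field outside the discs, its upward component
is nonnegative, and this component vanishes only at A and B (`fieldZ_eq_zero`). Height is monotone
along leaves, so a closed leaf lies over A or B; there the nonzero `spin` turns the circle into a
closed leaf (`IsClosedLeaf.eq_circleAt`, `isClosedLeaf_circleAt`). A leaf that enters over x = 0
stays over x = 0 and, by uniqueness, never passes the rest point A: it is infinite
(`hasInfiniteLeaf_vfield`).

The angular speed is `spin + twist`, where `twist` is the rate at which the planar trajectory turns
about A. Near the boundary `spin` vanishes, so rotating a vertical segment by the direction from A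
gives a leaf; this rotation is the attaching map. It makes one full turn around the boundary of the
square, which is the Dehn twist: the curve m − l, whose angle runs backwards once, is straightened
into the boundary of a slice of constant θ (`attachFun_slopeCurve`).

Once this rotation is undone, the remaining angle, `phase`, changes at the rate `spin` alone. The
reflection z ↦ 5/4 − z exchanges A and B and reverses `fieldX` and `spin` while keeping `fieldZ`. A
leaf that crosses the plug is therefore symmetric in time about its crossing of height 5/8, so x
returns and the accumulated spin cancels (`reflection`, `crossing_matched`). The second closed leaf
is the price of this cancellation.

The boundary types are defined by the existence of a chart, so the entry, exit and parallel parts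
must be located for arbitrary charts. This is done with signs of derivatives of chart coordinates
along curves in the body (`IsTransverseIn.bottom`, `IsParallel.lateral`). -/

noncomputable section

namespace DehnPlug

/-! ### A smooth profile function -/

/-- A smooth positive function, equal to `1` near `0` and to `1 / s` for `s ≥ 1`. -/
def profile (s : ℝ) : ℝ := 1 + (1 / s - 1) * Real.smoothTransition (2 * s - 1)

theorem profile_eventuallyEq_one {s : ℝ} (hs : s < 1 / 2) : profile =ᶠ[nhds s] fun _ => 1 := by
  filter_upwards [eventually_lt_nhds hs] with y hy
  simp [profile, Real.smoothTransition.zero_of_nonpos (by linarith : 2 * y - 1 ≤ 0)]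

/-- The cutoff vanishes for s ≤ 1/2, so the pole of 1/s at 0 plays no role. -/
theorem contDiff_profile : ContDiff ℝ ∞ profile := by
  rw [contDiff_iff_contDiffAt]
  intro s
  by_cases hs : s < 1 / 2
  · exact contDiffAt_const.congr_of_eventuallyEq (profile_eventuallyEq_one hs)
  · have h0 : s ≠ 0 := by linarith
    have : ContDiffAt ℝ ∞ (fun s : ℝ => Real.smoothTransition (2 * s - 1)) s :=
      (Real.smoothTransition.contDiff.comp (by fun_prop)).contDiffAt
    unfold profile
    exact contDiffAt_const.add
      (((contDiffAt_const.div contDiffAt_id h0).sub contDiffAt_const).mul this)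

/-- The derivative of `profile`. -/
def profile' : ℝ → ℝ := deriv profile

/-- The second derivative of `profile`. -/
def profile'' : ℝ → ℝ := deriv profile'

theorem contDiff_profile' : ContDiff ℝ ∞ profile' := by
  have := contDiff_infty_iff_deriv.1 contDiff_profile
  exact this.2

theorem hasDerivAt_profile (s : ℝ) : HasDerivAt profile (profile' s) s :=
  (contDiff_profile.differentiable (by simp) s).hasDerivAt

theorem hasDerivAt_profile' (s : ℝ) : HasDerivAt profile' (profile'' s) s :=
  (contDiff_profile'.differentiable (by simp) s).hasDerivAt

/-- The smooth function `s * profile s`, which vanishes at `0` and equals `1` for `s ≥ 1`. -/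
def ramp (s : ℝ) : ℝ := s * profile s

/-- The derivative of `ramp`. -/
def ramp' (s : ℝ) : ℝ := profile s + s * profile' s

/-- The second derivative of `ramp`. -/
def ramp'' (s : ℝ) : ℝ := 2 * profile' s + s * profile'' s

theorem hasDerivAt_ramp (s : ℝ) : HasDerivAt ramp (ramp' s) s := by
  have := (hasDerivAt_id s).mul (hasDerivAt_profile s)
  exact HasDerivAt.congr_deriv (f := ramp) this (by simp [ramp'])

theorem hasDerivAt_ramp' (s : ℝ) : HasDerivAt ramp' (ramp'' s) s := by
  have := (hasDerivAt_profile s).add ((hasDerivAt_id s).mul (hasDerivAt_profile' s))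
  exact HasDerivAt.congr_deriv (f := ramp') this (by simp [ramp'']; ring)

@[fun_prop]
theorem contDiff_ramp : ContDiff ℝ ∞ ramp := contDiff_id.mul contDiff_profile

@[fun_prop]
theorem contDiff_ramp' : ContDiff ℝ ∞ ramp' :=
  contDiff_profile.add (contDiff_id.mul contDiff_profile')

attribute [fun_prop] contDiff_profile contDiff_profile'

/-- After cancellation this is a convex combination of s and 1, from which sign, upper bound and
monotonicity are read off. -/
theorem ramp_eq (s : ℝ) : ramp s = s + (1 - s) * Real.smoothTransition (2 * s - 1) := by
  rcases eq_or_ne s 0 with rfl | h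
  · simp [ramp, Real.smoothTransition.zero_of_nonpos]
  · unfold ramp profile
    field_simp

theorem ramp_zero : ramp 0 = 0 := by simp [ramp]

theorem ramp_eq_one {s : ℝ} (hs : 1 ≤ s) : ramp s = 1 := by
  rw [ramp_eq, Real.smoothTransition.one_of_one_le (by linarith)]; ring

theorem ramp_pos {s : ℝ} (hs : 0 < s) : 0 < ramp s := by
  rw [ramp_eq]
  rcases lt_or_ge s 1 with h | h
  · have := Real.smoothTransition.nonneg (2 * s - 1)
    have := mul_nonneg (by linarith : 0 ≤ 1 - s) this
    linarith
  · rw [Real.smoothTransition.one_of_one_le (by linarith)]; linarith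

theorem ramp_nonneg {s : ℝ} (hs : 0 ≤ s) : 0 ≤ ramp s := by
  rcases hs.eq_or_lt with rfl | h
  · simp [ramp]
  · exact (ramp_pos h).le

theorem ramp_le_one (s : ℝ) : ramp s ≤ 1 := by
  rcases lt_or_ge s 1 with h | h
  · rw [ramp_eq]
    have := Real.smoothTransition.le_one (2 * s - 1)
    nlinarith
  · rw [ramp_eq_one h]

theorem ramp'_eq_zero {s : ℝ} (hs : 1 < s) : ramp' s = 0 := by
  have h : ramp =ᶠ[nhds s] fun _ => 1 := by
    filter_upwards [eventually_gt_nhds hs] with y hy using ramp_eq_one hy.le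
  exact ((hasDerivAt_ramp s).congr_of_eventuallyEq h.symm).unique (hasDerivAt_const s 1)

/-- For s ≤ 1 one has `ramp s` = 1 − (1 − s)(1 − T) with T the cutoff, and both factors are
nonnegative and nonincreasing. The sign of `fieldZ` rests on this. -/
theorem monotone_ramp : Monotone ramp := by
  have h : ∀ s t : ℝ, s ≤ t → t ≤ 1 → ramp s ≤ ramp t := by
    intro s t hst ht
    rw [ramp_eq, ramp_eq]
    have h1 := Real.smoothTransition.monotone (by linarith : 2 * s - 1 ≤ 2 * t - 1)
    have h2 := Real.smoothTransition.le_one (2 * s - 1)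
    nlinarith
  intro s t hst
  rcases le_total t 1 with ht | ht
  · exact h s t hst ht
  · rcases le_total s 1 with hs | hs
    · calc ramp s ≤ ramp 1 := h s 1 hs le_rfl
        _ = ramp t := by rw [ramp_eq_one le_rfl, ramp_eq_one ht]
    · rw [ramp_eq_one hs, ramp_eq_one ht]

theorem ramp'_nonneg (s : ℝ) : 0 ≤ ramp' s := by
  rw [← (hasDerivAt_ramp s).deriv]
  exact monotone_ramp.deriv_nonneg

/-! ### The planar field and its angular companion -/

/-- Scaled squared distance from `(0, 1/2)`. -/
def distA (x z : ℝ) : ℝ := 64 * (x ^ 2 + (z - 1 / 2) ^ 2)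

/-- Scaled squared distance from `(0, 3/4)`. -/
def distB (x z : ℝ) : ℝ := 64 * (x ^ 2 + (z - 3 / 4) ^ 2)

/-- The damping factor: the planar Hamiltonian is `x * damp x z`. -/
def damp (x z : ℝ) : ℝ := ramp (distA x z) * ramp (distB x z)

/-- The partial derivative of `damp` in `x`, divided by `x`. -/
def dampX (x z : ℝ) : ℝ :=
  128 * (ramp' (distA x z) * ramp (distB x z) + ramp (distA x z) * ramp' (distB x z))

/-- The partial derivative of `damp` in `z`. -/
def dampZ (x z : ℝ) : ℝ :=
  128 * ((z - 1 / 2) * ramp' (distA x z) * ramp (distB x z) +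
    (z - 3 / 4) * ramp (distA x z) * ramp' (distB x z))

/-- First component of the planar Hamiltonian field. -/
def fieldX (x z : ℝ) : ℝ := -(x * dampZ x z)

/-- Second component of the planar Hamiltonian field. -/
def fieldZ (x z : ℝ) : ℝ := damp x z + x ^ 2 * dampX x z

/-- Angular speed, antisymmetric in `z` about `5/8`. -/
def spin (x z : ℝ) : ℝ := (z - 5 / 8) * (1 - damp x z)

/-- The derivative along the planar field of the polar angle about `(0, 1/2)`. -/
def twist (x z : ℝ) : ℝ :=
  64 * x * (3 * (profile (distA x z) * ramp (distB x z)) +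
    128 * ((x ^ 2 + (z - 1 / 2) ^ 2) * profile' (distA x z) * ramp (distB x z) +
      (x ^ 2 + (z - 1 / 2) * (z - 3 / 4)) * profile (distA x z) * ramp' (distB x z)))

/-- The angular velocity about A is the right side divided by the squared distance from A. The
quotient extends smoothly over A: the terms with `ramp (distA x z)` contain that factor because
`ramp s = s * profile s`, and the terms with `ramp' (distA x z)` add up to a multiple of it. -/
theorem twist_mul (x z : ℝ) :
    (x ^ 2 + (z - 1 / 2) ^ 2) * twist x z = x * fieldZ x z - (z - 1 / 2) * fieldX x z := by
  -- The factors in `distB` are kept as free variables, so that inserting the formula for `distA`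
  -- leaves a polynomial identity.
  have h : ∀ b b', distA x z = 64 * (x ^ 2 + (z - 1 / 2) ^ 2) → 
    (x ^ 2 + (z - 1 / 2) ^ 2) * (64 * x * (3 * (profile (distA x z) * b) +
    128 * ((x ^ 2 + (z - 1 / 2) ^ 2) * profile' (distA x z) * b +
      (x ^ 2 + (z - 1 / 2) * (z - 3 / 4)) * profile (distA x z) * b'))) =
      x * (ramp (distA x z) * b + x ^ 2 * (128 * (ramp' (distA x z) * b + ramp (distA x z) * b')))
       - (z - 1 / 2) * (-(x * (128 * ((z - 1 / 2) * ramp' (distA x z) * b +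
    (z - 3 / 4) * ramp (distA x z) * b')))) := by
    intro b b' hd
    unfold ramp ramp'
    generalize profile (distA x z) = p
    generalize profile' (distA x z) = p'
    rw [hd]
    ring
  exact h _ _ rfl

/-! ### Sign and zeros of the planar field. -/

theorem distA_nonneg (x z : ℝ) : 0 ≤ distA x z := by unfold distA; positivity
theorem distB_nonneg (x z : ℝ) : 0 ≤ distB x z := by unfold distB; positivity

theorem damp_nonneg (x z : ℝ) : 0 ≤ damp x z :=
  mul_nonneg (ramp_nonneg (distA_nonneg x z)) (ramp_nonneg (distB_nonneg x z))

theorem damp_le_one (x z : ℝ) : damp x z ≤ 1 :=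
  mul_le_one₀ (ramp_le_one _) (ramp_nonneg (distB_nonneg x z))
    (ramp_le_one _)

theorem dampX_nonneg (x z : ℝ) : 0 ≤ dampX x z := by
  have := ramp_nonneg (distA_nonneg x z)
  have := ramp_nonneg (distB_nonneg x z)
  have := ramp'_nonneg (distA x z)
  have := ramp'_nonneg (distB x z)
  unfold dampX; positivity

theorem fieldZ_nonneg (x z : ℝ) : 0 ≤ fieldZ x z :=
  add_nonneg (damp_nonneg x z) (mul_nonneg (sq_nonneg x) (dampX_nonneg x z))

theorem damp_eq_zero {x z : ℝ} (h : damp x z = 0) : x = 0 ∧ (z = 1 / 2 ∨ z = 3 / 4) := by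
  rcases mul_eq_zero.1 h with h | h
  · have h0 : distA x z = 0 := by
      by_contra hne
      exact (ramp_pos (lt_of_le_of_ne (distA_nonneg x z) (Ne.symm hne))).ne' h
    unfold distA at h0
    have hx : x ^ 2 = 0 := by nlinarith [sq_nonneg x, sq_nonneg (z - 1 / 2)]
    have hz : (z - 1 / 2) ^ 2 = 0 := by nlinarith [sq_nonneg x, sq_nonneg (z - 1 / 2)]
    refine ⟨by simpa using hx, Or.inl ?_⟩
    have := pow_eq_zero_iff (two_ne_zero) |>.1 hz
    linarith
  · have h0 : distB x z = 0 := by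
      by_contra hne
      exact (ramp_pos (lt_of_le_of_ne (distB_nonneg x z) (Ne.symm hne))).ne' h
    unfold distB at h0
    have hx : x ^ 2 = 0 := by nlinarith [sq_nonneg x, sq_nonneg (z - 3 / 4)]
    have hz : (z - 3 / 4) ^ 2 = 0 := by nlinarith [sq_nonneg x, sq_nonneg (z - 3 / 4)]
    refine ⟨by simpa using hx, Or.inr ?_⟩
    have := pow_eq_zero_iff (two_ne_zero) |>.1 hz
    linarith

theorem fieldZ_eq_zero {x z : ℝ} (h : fieldZ x z = 0) : x = 0 ∧ (z = 1 / 2 ∨ z = 3 / 4) := by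
  apply damp_eq_zero
  have h1 := damp_nonneg x z
  have h2 := mul_nonneg (sq_nonneg x) (dampX_nonneg x z)
  unfold fieldZ at h
  linarith

theorem damp_half : damp 0 (1 / 2) = 0 := by simp [damp, distA, ramp_zero]
theorem damp_three_quarters : damp 0 (3 / 4) = 0 := by simp [damp, distB, ramp_zero]

theorem fieldX_zero (z : ℝ) : fieldX 0 z = 0 := by simp [fieldX]
theorem fieldZ_zero (z : ℝ) : fieldZ 0 z = damp 0 z := by simp [fieldZ]
theorem twist_zero (z : ℝ) : twist 0 z = 0 := by simp [twist]

/-- The region where the planar field is vertical of unit speed. -/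
def IsOuter (x z : ℝ) : Prop := 1 < distA x z ∧ 1 < distB x z

section outer
variable {x z : ℝ}

theorem IsOuter.damp (h : IsOuter x z) : damp x z = 1 := by
  simp [DehnPlug.damp, ramp_eq_one h.1.le, ramp_eq_one h.2.le]

theorem IsOuter.fieldX (h : IsOuter x z) : fieldX x z = 0 := by
  simp [DehnPlug.fieldX, dampZ, ramp'_eq_zero h.1, ramp'_eq_zero h.2]

theorem IsOuter.fieldZ (h : IsOuter x z) : fieldZ x z = 1 := by
  simp [DehnPlug.fieldZ, dampX, ramp'_eq_zero h.1, ramp'_eq_zero h.2, h.damp]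

theorem IsOuter.spin (h : IsOuter x z) : spin x z = 0 := by
  simp [DehnPlug.spin, h.damp]

theorem IsOuter.twist (h : IsOuter x z) :
    twist x z = x / (x ^ 2 + (z - 1 / 2) ^ 2) := by
  have h0 : x ^ 2 + (z - 1 / 2) ^ 2 ≠ 0 := by
    have := h.1
    unfold distA at this
    intro h; linarith
  rw [eq_div_iff h0, mul_comm, twist_mul, h.fieldX, h.fieldZ]
  ring

end outer

theorem isOuter_of_abs {x z : ℝ} (h : 1 / 2 ≤ |x|) : IsOuter x z := by
  have : 1 / 4 ≤ x ^ 2 := by rw [← sq_abs]; nlinarith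
  constructor
  · unfold distA; nlinarith [sq_nonneg (z - 1 / 2)]
  · unfold distB; nlinarith [sq_nonneg (z - 3 / 4)]

theorem isOuter_of_le {x z : ℝ} (h : z ≤ 1 / 4) : IsOuter x z := by
  constructor
  · unfold distA; nlinarith [sq_nonneg x]
  · unfold distB; nlinarith [sq_nonneg x]

theorem isOuter_of_ge {x z : ℝ} (h : 1 ≤ z) : IsOuter x z := by
  constructor
  · unfold distA; nlinarith [sq_nonneg x]
  · unfold distB; nlinarith [sq_nonneg x]

/-- The reflection in height 5/8 exchanges the centres of the two discs. By the lemmas that follow,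
it carries planar solutions to planar solutions when time is reversed, and it reverses the spin. -/
theorem distA_reflect (x z : ℝ) : distA x (5 / 4 - z) = distB x z := by
  unfold distA distB; ring

theorem distB_reflect (x z : ℝ) : distB x (5 / 4 - z) = distA x z := by
  unfold distA distB; ring

theorem damp_reflect (x z : ℝ) : damp x (5 / 4 - z) = damp x z := by
  unfold damp; rw [distA_reflect, distB_reflect, mul_comm]

theorem fieldX_reflect (x z : ℝ) : fieldX x (5 / 4 - z) = -fieldX x z := by
  unfold fieldX dampZ; rw [distA_reflect, distB_reflect]; ring

theorem fieldZ_reflect (x z : ℝ) : fieldZ x (5 / 4 - z) = fieldZ x z := by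
  unfold fieldZ dampX; rw [distA_reflect, distB_reflect, damp_reflect]; ring

theorem spin_reflect (x z : ℝ) : spin x (5 / 4 - z) = -spin x z := by
  unfold spin; rw [damp_reflect]; ring

section smooth
variable {E : Type*} [NormedAddCommGroup E] [NormedSpace ℝ E] {u v : E → ℝ}

@[fun_prop]
theorem ContDiff.damp (hu : ContDiff ℝ ∞ u) (hv : ContDiff ℝ ∞ v) :
    ContDiff ℝ ∞ fun y => damp (u y) (v y) := by
  unfold DehnPlug.damp distA distB; fun_prop

@[fun_prop]
theorem ContDiff.fieldX (hu : ContDiff ℝ ∞ u) (hv : ContDiff ℝ ∞ v) :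
    ContDiff ℝ ∞ fun y => fieldX (u y) (v y) := by
  unfold DehnPlug.fieldX DehnPlug.dampZ distA distB; fun_prop

@[fun_prop]
theorem ContDiff.fieldZ (hu : ContDiff ℝ ∞ u) (hv : ContDiff ℝ ∞ v) :
    ContDiff ℝ ∞ fun y => fieldZ (u y) (v y) := by
  unfold DehnPlug.fieldZ DehnPlug.dampX DehnPlug.damp distA distB; fun_prop

@[fun_prop]
theorem ContDiff.spin (hu : ContDiff ℝ ∞ u) (hv : ContDiff ℝ ∞ v) :
    ContDiff ℝ ∞ fun y => spin (u y) (v y) := by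
  unfold DehnPlug.spin DehnPlug.damp distA distB; fun_prop

@[fun_prop]
theorem ContDiff.twist (hu : ContDiff ℝ ∞ u) (hv : ContDiff ℝ ∞ v) :
    ContDiff ℝ ∞ fun y => twist (u y) (v y) := by
  unfold DehnPlug.twist distA distB; fun_prop

end smooth

/-- Mixed second partial derivative of the planar Hamiltonian. -/
theorem exists_hasDerivAt_field (x z : ℝ) : ∃ c, HasDerivAt (fun x => fieldX x z) (-c) x ∧
    HasDerivAt (fun z => fieldZ x z) c z := by
  have hA : ∀ x z, HasDerivAt (fun x => distA x z) (128 * x) x := fun x z => by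
    exact HasDerivAt.congr_deriv ((((hasDerivAt_id x).pow 2).add_const ((z - 1 / 2) ^ 2)).const_mul 64)
      (by simp; ring)
  have hB : ∀ x z, HasDerivAt (fun x => distB x z) (128 * x) x := fun x z => by
    exact HasDerivAt.congr_deriv ((((hasDerivAt_id x).pow 2).add_const ((z - 3 / 4) ^ 2)).const_mul 64)
      (by simp; ring)
  have hA' : ∀ x z, HasDerivAt (fun z => distA x z) (128 * (z - 1 / 2)) z := fun x z => by
    exact HasDerivAt.congr_deriv (((((hasDerivAt_id z).sub_const (1 / 2)).pow 2).const_add (x ^ 2)).const_mul 64)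
      (by simp; ring)
  have hB' : ∀ x z, HasDerivAt (fun z => distB x z) (128 * (z - 3 / 4)) z := fun x z => by
    exact HasDerivAt.congr_deriv (((((hasDerivAt_id z).sub_const (3 / 4)).pow 2).const_add (x ^ 2)).const_mul 64)
      (by simp; ring)
  have a := (hasDerivAt_ramp _).comp x (hA x z)
  have b := (hasDerivAt_ramp _).comp x (hB x z)
  have a' := (hasDerivAt_ramp' _).comp x (hA x z)
  have b' := (hasDerivAt_ramp' _).comp x (hB x z)
  have p := (hasDerivAt_ramp _).comp z (hA' x z)
  have q := (hasDerivAt_ramp _).comp z (hB' x z)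
  have p' := (hasDerivAt_ramp' _).comp z (hA' x z)
  have q' := (hasDerivAt_ramp' _).comp z (hB' x z)
  have h1 := ((hasDerivAt_id x).mul ((((a'.const_mul (z - 1 / 2)).mul b).add
    ((a.const_mul (z - 3 / 4)).mul b')).const_mul 128)).neg
  have h2 := (p.mul q).add ((((p'.mul q).add (p.mul q')).const_mul 128).const_mul (x ^ 2))
  -- The constant is read off from ∂`fieldZ`/∂z; that −∂`fieldX`/∂x agrees with it is the symmetry
  -- of second derivatives of the Hamiltonian, checked here by expansion.
  refine ⟨_, ?_, h2⟩
  refine HasDerivAt.congr_deriv (f := fun x => fieldX x z) h1 ?_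
  simp only [Function.comp_apply, id, Pi.mul_apply, Pi.add_apply]
  ring

/-! ### Cylindrical notation -/

/-- The horizontal part of a point of space, as a complex number. -/
def horiz (q : E3) : ℂ := ⟨q 0, q 1⟩

/-- The point of space with a given horizontal part and height. -/
def mkPt (c : ℂ) (z : ℝ) : E3 := !₂[c.re, c.im, z]

/-- A point of the plane as a complex number. -/
def toC (x : E2) : ℂ := ⟨x 0, x 1⟩

/-- A complex number as a point of the plane. -/
def ofC (c : ℂ) : E2 := !₂[c.re, c.im]

@[simp] theorem horiz_mkPt (c : ℂ) (z : ℝ) : horiz (mkPt c z) = c := rfl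
@[simp] theorem mkPt_two (c : ℂ) (z : ℝ) : mkPt c z 2 = z := rfl
@[simp] theorem mkPt_zero (c : ℂ) (z : ℝ) : mkPt c z 0 = c.re := rfl
@[simp] theorem mkPt_one (c : ℂ) (z : ℝ) : mkPt c z 1 = c.im := rfl
@[simp] theorem horiz_re (q : E3) : (horiz q).re = q 0 := rfl
@[simp] theorem horiz_im (q : E3) : (horiz q).im = q 1 := rfl
@[simp] theorem toC_ofC (c : ℂ) : toC (ofC c) = c := rfl

@[simp] theorem mkPt_horiz (q : E3) : mkPt (horiz q) (q 2) = q := by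
  ext i; fin_cases i <;> rfl

@[simp] theorem ofC_toC (x : E2) : ofC (toC x) = x := by
  ext i; fin_cases i <;> rfl

theorem lift_eq (x : E2) (z : ℝ) : lift x z = mkPt (toC x) z := rfl

theorem ext_horiz {p q : E3} (h : horiz p = horiz q) (h2 : p 2 = q 2) : p = q := by
  rw [← mkPt_horiz p, ← mkPt_horiz q, h, h2]

theorem norm_toC (x : E2) : ‖toC x‖ = ‖x‖ := by
  rw [EuclideanSpace.norm_eq, Complex.norm_eq_sqrt_sq_add_sq]
  simp [toC, Fin.sum_univ_two]

/-- Space as the product of the complex plane and the line. -/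
def splitE3 : E3 ≃L[ℝ] ℂ × ℝ :=
  LinearEquiv.toContinuousLinearEquiv
    { toFun := fun q => (horiz q, q 2)
      invFun := fun p => mkPt p.1 p.2
      map_add' := fun p q => by
        refine Prod.ext (Complex.ext ?_ ?_) ?_ <;> simp [horiz]
      map_smul' := fun c q => by
        refine Prod.ext (Complex.ext ?_ ?_) ?_ <;> simp [horiz]
      left_inv := fun q => mkPt_horiz q
      right_inv := fun p => rfl }

/-- The plane as the complex plane. -/
def planeC : E2 ≃L[ℝ] ℂ :=
  LinearEquiv.toContinuousLinearEquiv
    { toFun := toC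
      invFun := ofC
      map_add' := fun p q => by refine Complex.ext ?_ ?_ <;> simp [toC]
      map_smul' := fun c q => by refine Complex.ext ?_ ?_ <;> simp [toC]
      left_inv := fun q => ofC_toC q
      right_inv := fun p => rfl }

@[fun_prop]
theorem contDiff_horiz : ContDiff ℝ ∞ horiz := contDiff_fst.comp splitE3.contDiff

@[fun_prop]
theorem contDiff_toC : ContDiff ℝ ∞ toC := planeC.contDiff

@[fun_prop]
theorem continuous_horiz : Continuous horiz := contDiff_horiz.continuous

theorem ContDiffWithinAt.mkPt {E : Type*} [NormedAddCommGroup E] [NormedSpace ℝ E] {f : E → ℂ}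
    {g : E → ℝ} {s : Set E} {x : E} {n : WithTop ℕ∞} (hf : ContDiffWithinAt ℝ n f s x)
    (hg : ContDiffWithinAt ℝ n g s x) :
    ContDiffWithinAt ℝ n (fun y => mkPt (f y) (g y)) s x :=
  splitE3.symm.contDiff.contDiffAt.comp_contDiffWithinAt x (hf.prodMk hg)

theorem ContDiffAt.mkPt {E : Type*} [NormedAddCommGroup E] [NormedSpace ℝ E] {f : E → ℂ}
    {g : E → ℝ} {x : E} {n : WithTop ℕ∞} (hf : ContDiffAt ℝ n f x) (hg : ContDiffAt ℝ n g x) :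
    ContDiffAt ℝ n (fun y => mkPt (f y) (g y)) x :=
  splitE3.symm.contDiff.contDiffAt.comp x (hf.prodMk hg)

@[fun_prop]
theorem Continuous.mkPt {X : Type*} [TopologicalSpace X] {f : X → ℂ} {g : X → ℝ}
    (hf : Continuous f) (hg : Continuous g) : Continuous fun y => mkPt (f y) (g y) :=
  splitE3.symm.continuous.comp (hf.prodMk hg)

theorem HasDerivWithinAt.mkPt {f : ℝ → ℂ} {g : ℝ → ℝ} {f' : ℂ} {g' : ℝ} {s : Set ℝ} {t : ℝ}
    (hf : HasDerivWithinAt f f' s t) (hg : HasDerivWithinAt g g' s t) :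
    HasDerivWithinAt (fun y => mkPt (f y) (g y)) (mkPt f' g') s t :=
  splitE3.symm.hasFDerivAt.comp_hasDerivWithinAt t (hf.prodMk hg)

theorem HasDerivAt.mkPt {f : ℝ → ℂ} {g : ℝ → ℝ} {f' : ℂ} {g' : ℝ} {t : ℝ}
    (hf : HasDerivAt f f' t) (hg : HasDerivAt g g' t) :
    HasDerivAt (fun y => mkPt (f y) (g y)) (mkPt f' g') t :=
  splitE3.symm.hasFDerivAt.comp_hasDerivAt t (hf.prodMk hg)

theorem HasDerivWithinAt.horiz {γ : ℝ → E3} {v : E3} {s : Set ℝ} {t : ℝ}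
    (h : HasDerivWithinAt γ v s t) : HasDerivWithinAt (fun t => horiz (γ t)) (horiz v) s t :=
  ((ContinuousLinearMap.fst ℝ ℂ ℝ).comp (splitE3 : E3 →L[ℝ] ℂ × ℝ)).hasFDerivAt.comp_hasDerivWithinAt t h

theorem HasDerivWithinAt.height {γ : ℝ → E3} {v : E3} {s : Set ℝ} {t : ℝ}
    (h : HasDerivWithinAt γ v s t) : HasDerivWithinAt (fun t => γ t 2) (v 2) s t :=
  ((ContinuousLinearMap.snd ℝ ℂ ℝ).comp (splitE3 : E3 →L[ℝ] ℂ × ℝ)).hasFDerivAt.comp_hasDerivWithinAt t h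

/-- The squared distance from the axis. -/
def nu (q : E3) : ℝ := q 0 ^ 2 + q 1 ^ 2

theorem nu_eq (q : E3) : nu q = ‖horiz q‖ ^ 2 := by
  rw [← Complex.normSq_eq_norm_sq, Complex.normSq_apply, horiz_re, horiz_im, nu]; ring

theorem nu_mkPt (c : ℂ) (z : ℝ) : nu (mkPt c z) = ‖c‖ ^ 2 := by rw [nu_eq, horiz_mkPt]

@[fun_prop]
theorem contDiff_coord (i : Fin 3) : ContDiff ℝ ∞ fun q : E3 => q i :=
  contDiff_piLp_apply (𝕜 := ℝ) (p := 2)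

@[fun_prop]
theorem contDiff_nu : ContDiff ℝ ∞ nu := by unfold nu; fun_prop

@[fun_prop]
theorem continuous_nu : Continuous nu := contDiff_nu.continuous

/-! ### The plug -/

/-- The support of the plug. -/
def body : Set E3 := {q | (1 ≤ nu q ∧ nu q ≤ 2) ∧ 0 ≤ q 2 ∧ q 2 ≤ 1}

/-- Radial coordinate, centred. -/
def rad (q : E3) : ℝ := nu q - 3 / 2

@[fun_prop]
theorem contDiff_rad : ContDiff ℝ ∞ rad := by unfold rad; fun_prop

/-- Half the logarithmic rate of change of `nu` along the field. -/
def expand (q : E3) : ℝ := fieldX (rad q) (q 2) / (2 * nu q)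

/-- Angular speed of the field. -/
def speed (q : E3) : ℝ := spin (rad q) (q 2) + twist (rad q) (q 2)

/-- The vector field of the plug. -/
def vfield (q : E3) : E3 :=
  mkPt ((expand q + speed q * Complex.I) * horiz q) (fieldZ (rad q) (q 2))

theorem vfield_zero (q : E3) : vfield q 0 = expand q * q 0 - speed q * q 1 := by
  simp [vfield]

theorem vfield_one (q : E3) : vfield q 1 = expand q * q 1 + speed q * q 0 := by
  simp [vfield]

@[simp] theorem vfield_two (q : E3) : vfield q 2 = fieldZ (rad q) (q 2) := rfl
@[simp] theorem horiz_vfield (q : E3) :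
    horiz (vfield q) = (expand q + speed q * Complex.I) * horiz q := rfl

theorem contDiffAt_expand {q : E3} (h : nu q ≠ 0) : ContDiffAt ℝ ∞ expand q := by
  unfold expand
  exact ContDiffAt.div (by fun_prop) (by fun_prop) (by simpa using h)

theorem contDiff_speed : ContDiff ℝ ∞ speed := by unfold speed; fun_prop

theorem contDiffAt_vfield {q : E3} (h : nu q ≠ 0) : ContDiffAt ℝ ∞ vfield q := by
  unfold vfield
  refine ContDiffAt.mkPt (ContDiffAt.mul (ContDiffAt.add ?_ (ContDiffAt.mul ?_ contDiffAt_const))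
    (by fun_prop)) (by fun_prop)
  · exact Complex.ofRealCLM.contDiff.contDiffAt.comp q (contDiffAt_expand h)
  · exact Complex.ofRealCLM.contDiff.contDiffAt.comp q contDiff_speed.contDiffAt

theorem body_nu_pos {q : E3} (h : q ∈ body) : 0 < nu q := by linarith [h.1.1]

theorem contDiffOn_vfield : ContDiffOn ℝ ∞ vfield body := fun _ hq =>
  (contDiffAt_vfield (body_nu_pos hq).ne').contDiffWithinAt

theorem vfield_ne_zero {q : E3} (hq : q ∈ body) : vfield q ≠ 0 := by
  intro h
  have h2 : fieldZ (rad q) (q 2) = 0 := by rw [← vfield_two, h]; rfl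
  have hc : ((expand q : ℂ) + speed q * Complex.I) * horiz q = 0 := by
    rw [← horiz_vfield, h]; rfl
  have hq0 : horiz q ≠ 0 := by
    intro h0
    have := body_nu_pos hq
    rw [nu_eq, h0] at this
    simp at this
  have him := congrArg Complex.im ((mul_eq_zero.1 hc).resolve_right hq0)
  have hs : speed q = 0 := by simpa using him
  obtain ⟨hx, hz⟩ := fieldZ_eq_zero h2
  rw [speed, hx, twist_zero] at hs
  rcases hz with hz | hz <;> rw [hz] at hs <;>
    norm_num [spin, damp_half, damp_three_quarters] at hs

/-! ### Unique differentiability -/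

/-- The shell is not convex near its inner sphere. At a point x of that sphere the half-space ⟨x, y⟩
≥ a² avoids the open ball of radius a by Cauchy–Schwarz, so it supplies a convex subset with
interior; elsewhere the closed outer ball does. -/
theorem uniqueDiffOn_shell {E : Type*} [NormedAddCommGroup E] [InnerProductSpace ℝ E] {a b : ℝ}
    (ha : 0 < a) (hab : a < b) : UniqueDiffOn ℝ {x : E | a ≤ ‖x‖ ∧ ‖x‖ ≤ b} := by
  rintro x ⟨h1, h2⟩
  rcases h1.eq_or_lt with h | h
  · have hb : ‖x‖ < b := h ▸ hab
    have hx : x ≠ 0 := by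
      rintro rfl
      rw [norm_zero] at h
      linarith
    have hU : {x : E | ‖x‖ < b} ∈ nhds x :=
      (isOpen_lt continuous_norm continuous_const).mem_nhds hb
    let f : E →L[ℝ] ℝ := innerSL ℝ x
    have hs : {y : E | a ^ 2 ≤ f y} ∩ {x : E | ‖x‖ < b} ⊆ {x : E | a ≤ ‖x‖ ∧ ‖x‖ ≤ b} := by
      rintro y ⟨hy1, hy2⟩
      refine ⟨?_, le_of_lt hy2⟩
      have h3 : a ^ 2 ≤ ‖x‖ * ‖y‖ := le_trans hy1 (real_inner_le_norm x y)
      rw [← h, sq] at h3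
      exact le_of_mul_le_mul_left h3 ha
    refine UniqueDiffWithinAt.mono ?_ hs
    rw [uniqueDiffWithinAt_inter hU]
    refine uniqueDiffWithinAt_convex ?_ ?_ (subset_closure ?_)
    · exact convex_halfSpace_ge f.isLinear _
    · refine ⟨(2 : ℝ) • x, mem_interior.2 ⟨{y : E | a ^ 2 < f y}, fun y (hy : a ^ 2 < f y) => hy.le,
        isOpen_lt continuous_const f.continuous, ?_⟩⟩
      simp only [Set.mem_ofPred_eq, f, innerSL_apply_apply, inner_smul_right,
        real_inner_self_eq_norm_sq, ← h]
      nlinarith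
    · simp [f, h]
  · have hU : {x : E | a < ‖x‖} ∈ nhds x :=
      (isOpen_lt continuous_const continuous_norm).mem_nhds h
    have hs : Metric.closedBall (0 : E) b ∩ {x : E | a < ‖x‖} ⊆
        {x : E | a ≤ ‖x‖ ∧ ‖x‖ ≤ b} := by
      rintro y ⟨hy1, hy2⟩
      exact ⟨le_of_lt hy2, by simpa using hy1⟩
    refine UniqueDiffWithinAt.mono ?_ hs
    rw [uniqueDiffWithinAt_inter hU]
    refine uniqueDiffWithinAt_convex (convex_closedBall _ _) ?_ (subset_closure (by simpa using h2))
    exact ⟨0, mem_interior.2 ⟨Metric.ball 0 b, Metric.ball_subset_closedBall, Metric.isOpen_ball,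
      by simpa using ha.trans hab⟩⟩

theorem uniqueDiffOn_cylinder {a b : ℝ} (ha : 0 < a) (hab : a < b) :
    UniqueDiffOn ℝ {q : E3 | (a ≤ ‖horiz q‖ ∧ ‖horiz q‖ ≤ b) ∧ 0 ≤ q 2 ∧ q 2 ≤ 1} := by
  have h := (uniqueDiffOn_shell (E := ℂ) ha hab).prod (uniqueDiffOn_Icc (zero_lt_one' ℝ))
  rw [← splitE3.uniqueDiffOn_preimage_iff] at h
  exact h

theorem uniqueDiffOn_annulus : UniqueDiffOn ℝ annulus :=
  uniqueDiffOn_shell one_pos one_lt_two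

theorem thickAnnulus_eq :
    thickAnnulus = {q : E3 | (1 ≤ ‖horiz q‖ ∧ ‖horiz q‖ ≤ 2) ∧ 0 ≤ q 2 ∧ q 2 ≤ 1} := by
  ext q
  constructor
  · rintro ⟨x, hx, z, hz, rfl⟩
    rw [lift_eq]
    have hx' : 1 ≤ ‖x‖ ∧ ‖x‖ ≤ 2 := hx
    exact ⟨by simpa [norm_toC] using hx', hz⟩
  · rintro ⟨h1, h2⟩
    refine ⟨ofC (horiz q), ?_, q 2, h2, ?_⟩
    · rw [annulus, Set.mem_ofPred_eq, ← norm_toC, toC_ofC]; exact h1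
    · rw [lift_eq, toC_ofC, mkPt_horiz]

theorem uniqueDiffOn_thickAnnulus : UniqueDiffOn ℝ thickAnnulus := by
  rw [thickAnnulus_eq]; exact uniqueDiffOn_cylinder one_pos one_lt_two

theorem body_eq :
    body = {q : E3 | (1 ≤ ‖horiz q‖ ∧ ‖horiz q‖ ≤ √2) ∧ 0 ≤ q 2 ∧ q 2 ≤ 1} := by
  ext q
  simp only [body, Set.mem_ofPred_eq, nu_eq]
  rw [Real.le_sqrt (norm_nonneg _) (by norm_num), one_le_sq_iff₀ (norm_nonneg _)]

theorem uniqueDiffOn_body : UniqueDiffOn ℝ body := by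
  rw [body_eq]; exact uniqueDiffOn_cylinder one_pos (by rw [Real.lt_sqrt] <;> norm_num)

theorem isClosed_body : IsClosed body := by
  have h2 : Continuous fun q : E3 => q 2 := (contDiff_coord 2).continuous
  exact ((isClosed_le continuous_const continuous_nu).inter
    (isClosed_le continuous_nu continuous_const)).inter
    ((isClosed_le continuous_const h2).inter (isClosed_le h2 continuous_const))

theorem isCompact_body : IsCompact body := by
  refine Metric.isCompact_of_isClosed_isBounded isClosed_body ?_
  refine (Metric.isBounded_closedBall (x := (0 : E3)) (r := 2)).subset fun q hq => ?_
  rw [mem_closedBall_zero_iff, EuclideanSpace.norm_eq, Real.sqrt_le_left (by norm_num)]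
  simp only [Fin.sum_univ_three, Real.norm_eq_abs, sq_abs]
  have := hq.1.2
  unfold nu at this
  nlinarith [hq.2.1, hq.2.2]

/-! ### Preservation of volume -/

theorem fderiv_coord_single {W : E3 → E3} {q : E3} (hW : DifferentiableAt ℝ W q) (i : Fin 3) {d : ℝ}
    (h : HasDerivAt (fun t : ℝ => W (q + t • EuclideanSpace.single i 1) i) d 0) :
    (fderiv ℝ W q (EuclideanSpace.single i 1)) i = d := by
  have h1 : HasDerivAt (fun t : ℝ => q + t • (EuclideanSpace.single i 1 : E3))
      (EuclideanSpace.single i 1) 0 := by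
    simpa using ((hasDerivAt_id (0 : ℝ)).smul_const (EuclideanSpace.single i 1 : E3)).const_add q
  have h2 : HasFDerivAt W (fderiv ℝ W q) (q + (0 : ℝ) • (EuclideanSpace.single i 1 : E3)) := by
    simpa using hW.hasFDerivAt
  have h3 := h2.comp_hasDerivAt (0 : ℝ) h1
  have h4 := (EuclideanSpace.proj (𝕜 := ℝ) i).hasFDerivAt.comp_hasDerivAt (0 : ℝ) h3
  exact h4.unique h

/-- In the coordinates (ν, θ, z) the volume is ½ dν dθ dz and the angular speed does not depend on
θ, so the divergence is ∂`fieldX`/∂x + ∂`fieldZ`/∂z. The computation below verifies this in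
Cartesian coordinates. -/
theorem divergence_vfield {q : E3} (hq : nu q ≠ 0) :
    ∑ i, (fderiv ℝ vfield q (EuclideanSpace.single i 1)) i = 0 := by
  have hd : DifferentiableAt ℝ vfield q := (contDiffAt_vfield hq).differentiableAt (by simp)
  obtain ⟨c, hc1, hc2⟩ := exists_hasDerivAt_field (rad q) (q 2)
  obtain ⟨b, hb⟩ : ∃ b, HasDerivAt (fun x => spin x (q 2) + twist x (q 2)) b (rad q) := by
    have : ContDiff ℝ ∞ fun x => spin x (q 2) + twist x (q 2) := by fun_prop
    exact ⟨_, (this.differentiable (by simp) _).hasDerivAt⟩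
  -- Here a is the derivative of `expand` in ν, and the equation is the quotient rule cleared of
  -- denominators.
  obtain ⟨a, ha, ha'⟩ : ∃ a, HasDerivAt (fun n => fieldX (n - 3 / 2) (q 2) / (2 * n)) a (nu q) ∧
      a * (2 * nu q ^ 2) = -c * nu q - fieldX (rad q) (q 2) := by
    have h1 : HasDerivAt (fun n : ℝ => fieldX (n - 3 / 2) (q 2)) (-c) (nu q) :=
      HasDerivAt.comp_sub_const (nu q) (3 / 2) hc1
    have h2 : HasDerivAt (fun n : ℝ => 2 * n) 2 (nu q) := by
      simpa using (hasDerivAt_id (nu q)).const_mul 2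
    refine ⟨_, h1.div h2 (by simpa using hq), ?_⟩
    rw [show nu q - 3 / 2 = rad q from rfl]
    field_simp
  have hb' : HasDerivAt (fun n => spin (n - 3 / 2) (q 2) + twist (n - 3 / 2) (q 2)) b (nu q) :=
    HasDerivAt.comp_sub_const (nu q) (3 / 2) hb
  have line (i : Fin 3) (t : ℝ) (j : Fin 3) :
      (q + t • (EuclideanSpace.single i 1 : E3)) j = q j + t * (if j = i then 1 else 0) := by
    simp
  have hid : HasDerivAt (fun t : ℝ => q 0 + t) 1 0 := by simpa using (hasDerivAt_id 0).const_add (q 0)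
  have hid' : HasDerivAt (fun t : ℝ => q 1 + t) 1 0 := by
    simpa using (hasDerivAt_id 0).const_add (q 1)
  have n0 : HasDerivAt (fun t : ℝ => (q 0 + t) ^ 2 + q 1 ^ 2) (2 * q 0) 0 := by
    simpa using (hid.pow 2).add_const (q 1 ^ 2)
  have n1 : HasDerivAt (fun t : ℝ => q 0 ^ 2 + (q 1 + t) ^ 2) (2 * q 1) 0 := by
    simpa using (hid'.pow 2).const_add (q 0 ^ 2)
  have e0 : nu q = (q 0 + 0) ^ 2 + q 1 ^ 2 := by simp [nu]
  have e1 : nu q = q 0 ^ 2 + (q 1 + 0) ^ 2 := by simp [nu]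
  have d0 := fderiv_coord_single hd 0 (d := a * (2 * q 0) * q 0 + expand q - b * (2 * q 0) * q 1) (by
    have A := HasDerivAt.comp (h₂ := fun n => fieldX (n - 3 / 2) (q 2) / (2 * n)) 0 (e0 ▸ ha) n0
    have B := HasDerivAt.comp
      (h₂ := fun n => spin (n - 3 / 2) (q 2) + twist (n - 3 / 2) (q 2)) 0 (e0 ▸ hb') n0
    have := (A.mul hid).sub (B.mul_const (q 1))
    simp only [vfield_zero, expand, speed, rad, nu, line]
    simp only [Fin.isValue, ↓reduceIte, mul_one, one_ne_zero, mul_zero, add_zero,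
      show (2 : Fin 3) ≠ 0 from by decide]
    refine HasDerivAt.congr_deriv this ?_
    simp)
  have d1 := fderiv_coord_single hd 1 (d := a * (2 * q 1) * q 1 + expand q + b * (2 * q 1) * q 0) (by
    have A := HasDerivAt.comp (h₂ := fun n => fieldX (n - 3 / 2) (q 2) / (2 * n)) 0 (e1 ▸ ha) n1
    have B := HasDerivAt.comp
      (h₂ := fun n => spin (n - 3 / 2) (q 2) + twist (n - 3 / 2) (q 2)) 0 (e1 ▸ hb') n1
    have := (A.mul hid').add (B.mul_const (q 0))
    simp only [vfield_one, expand, speed, rad, nu, line]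
    simp only [Fin.isValue, ↓reduceIte, mul_one, zero_ne_one, mul_zero, add_zero,
      show (2 : Fin 3) ≠ 1 from by decide]
    refine HasDerivAt.congr_deriv this ?_
    simp)
  have d2 := fderiv_coord_single hd 2 (d := c) (by
    have hid2 : HasDerivAt (fun t : ℝ => q 2 + t) 1 0 := by
      simpa using (hasDerivAt_id 0).const_add (q 2)
    have e2 : q 2 = q 2 + 0 := by simp
    have C := HasDerivAt.comp (h₂ := fun z => fieldZ (rad q) z) 0 (e2 ▸ hc2) hid2
    simp only [vfield_two, rad, nu, line]
    simp only [Fin.isValue, ↓reduceIte, mul_one, mul_zero, add_zero,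
      show (0 : Fin 3) ≠ 2 from by decide, show (1 : Fin 3) ≠ 2 from by decide]
    refine HasDerivAt.congr_deriv C (by simp))
  rw [Fin.sum_univ_three, d0, d1, d2]
  have : expand q * (2 * nu q) = fieldX (rad q) (q 2) := by
    unfold expand; field_simp
  have hn : nu q = q 0 ^ 2 + q 1 ^ 2 := rfl
  -- The two angular contributions ∓2b · q 0 · q 1 cancel; what is left of the divergence is the
  -- second factor.
  have key : nu q * (2 * a * nu q + 2 * expand q + c) = 0 := by linear_combination ha' + this
  have := (mul_eq_zero.1 key).resolve_left hq
  rw [hn] at this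
  linear_combination this

theorem isMeasured_vfield : IsMeasured vfield body := by
  refine ⟨fun _ => 1, contDiffOn_const, fun _ _ => one_pos, fun p hp => ?_⟩
  have hn := (body_nu_pos hp).ne'
  have hd : DifferentiableAt ℝ vfield p := (contDiffAt_vfield hn).differentiableAt (by simp)
  simp only [divWithin, one_smul]
  rw [hd.fderivWithin (uniqueDiffOn_body p hp)]
  exact divergence_vfield hn

/-! ### Corner charts of the body -/

/-- Coordinate functions of a corner chart: the signed distances to a lateral and a horizontal
face, and a tangential coordinate. -/
def cornerMap (σ τ : ℝ) (e : ℂ) (q : E3) : E3 :=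
  !₂[σ * (nu q - (3 - σ) / 2), (horiz q * e).im + 10, τ * (q 2 - (1 - τ) / 2)]

/-- The inverse of `cornerMap`. -/
def cornerInv (σ τ : ℝ) (e : ℂ) (y : E3) : E3 :=
  mkPt (⟨√((3 - σ) / 2 + σ * y 0 - (y 1 - 10) ^ 2), y 1 - 10⟩ * (starRingEnd ℂ) e)
    ((1 - τ) / 2 + τ * y 2)

/-- The source of a corner chart. -/
def cornerSource (σ τ : ℝ) (e : ℂ) : Set E3 :=
  {q | 0 < (horiz q * e).re ∧ σ * (nu q - (3 - σ) / 2) < 1 ∧ τ * (q 2 - (1 - τ) / 2) < 1}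

/-- The target of a corner chart. -/
def cornerTarget (σ : ℝ) : Set E3 :=
  {y | 0 < (3 - σ) / 2 + σ * y 0 - (y 1 - 10) ^ 2 ∧ y 0 < 1 ∧ y 2 < 1}

section corner
variable {σ τ : ℝ} {e : ℂ}

theorem normSq_horiz (q : E3) : (horiz q).re ^ 2 + (horiz q).im ^ 2 = nu q := rfl

theorem nu_rotate (he : e * (starRingEnd ℂ) e = 1) (q : E3) :
    nu q = (horiz q * e).re ^ 2 + (horiz q * e).im ^ 2 := by
  have h : Complex.normSq e = 1 := by
    have := Complex.mul_conj e
    rw [he] at this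
    exact_mod_cast this.symm
  have h2 : Complex.normSq (horiz q * e) = Complex.normSq (horiz q) := by rw [map_mul, h, mul_one]
  simp only [Complex.normSq_apply] at h2
  rw [← normSq_horiz]
  linarith

theorem contDiff_cornerMap : ContDiff ℝ ∞ (cornerMap σ τ e) := by
  have h : ContDiff ℝ ∞ fun q => (horiz q * e).im :=
    Complex.imCLM.contDiff.comp (contDiff_horiz.mul contDiff_const)
  rw [contDiff_euclidean]
  intro i
  fin_cases i
  · change ContDiff ℝ ∞ fun q => σ * (nu q - (3 - σ) / 2); fun_prop
  · change ContDiff ℝ ∞ fun q => (horiz q * e).im + 10; fun_prop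
  · change ContDiff ℝ ∞ fun q : E3 => τ * (q 2 - (1 - τ) / 2); fun_prop

theorem contDiffOn_cornerInv : ContDiffOn ℝ ∞ (cornerInv σ τ e) (cornerTarget σ) := by
  intro y hy
  apply ContDiffAt.contDiffWithinAt
  unfold cornerInv
  refine ContDiffAt.mkPt (ContDiffAt.mul ?_ contDiffAt_const) (by fun_prop)
  have h1 : ContDiffAt ℝ ∞ (fun y : E3 => √((3 - σ) / 2 + σ * y 0 - (y 1 - 10) ^ 2)) y :=
    ContDiffAt.sqrt (by fun_prop) hy.1.ne'
  have h2 : ContDiffAt ℝ ∞ (fun y : E3 => y 1 - 10) y := by fun_prop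
  exact Complex.equivRealProdCLM.symm.contDiff.contDiffAt.comp y (h1.prodMk h2)

theorem isOpen_cornerSource : IsOpen (cornerSource σ τ e) := by
  have h2 : Continuous fun q : E3 => q 2 := (contDiff_coord 2).continuous
  have a : Continuous fun q => (horiz q * e).re :=
    Complex.continuous_re.comp (continuous_horiz.mul continuous_const)
  have b : Continuous fun q => σ * (nu q - (3 - σ) / 2) := by fun_prop
  have c : Continuous fun q : E3 => τ * (q 2 - (1 - τ) / 2) := by fun_prop
  exact (isOpen_lt continuous_const a).inter ((isOpen_lt b continuous_const).inter
    (isOpen_lt c continuous_const))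

theorem isOpen_cornerTarget : IsOpen (cornerTarget σ) := by
  have h (i : Fin 3) : Continuous fun q : E3 => q i := (contDiff_coord i).continuous
  have h0 := h 0
  have h1 := h 1
  have h2 := h 2
  have a : Continuous fun y : E3 => (3 - σ) / 2 + σ * y 0 - (y 1 - 10) ^ 2 := by fun_prop
  exact (isOpen_lt continuous_const a).inter ((isOpen_lt h0 continuous_const).inter
    (isOpen_lt h2 continuous_const))

/-- A corner chart of the body. -/
def cornerChart (σ τ : ℝ) (e : ℂ) (hσ : σ * σ = 1) (hτ : τ * τ = 1)
    (he : e * (starRingEnd ℂ) e = 1) : OpenPartialHomeomorph E3 E3 where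
  toFun := cornerMap σ τ e
  invFun := cornerInv σ τ e
  source := cornerSource σ τ e
  target := cornerTarget σ
  map_source' q hq := by
    obtain ⟨h1, h2, h3⟩ := hq
    refine ⟨?_, h2, h3⟩
    have hn := nu_rotate he q
    have : (3 - σ) / 2 + σ * (σ * (nu q - (3 - σ) / 2)) - ((horiz q * e).im + 10 - 10) ^ 2
        = (horiz q * e).re ^ 2 := by linear_combination (nu q - (3 - σ) / 2) * hσ + hn
    change 0 < (3 - σ) / 2 + σ * (σ * (nu q - (3 - σ) / 2)) - ((horiz q * e).im + 10 - 10) ^ 2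
    rw [this]; positivity
  map_target' y hy := by
    obtain ⟨h1, h2, h3⟩ := hy
    have he' : (starRingEnd ℂ) e * e = 1 := by rw [mul_comm]; exact he
    have hc : horiz (cornerInv σ τ e y) * e =
        ⟨√((3 - σ) / 2 + σ * y 0 - (y 1 - 10) ^ 2), y 1 - 10⟩ := by
      rw [cornerInv, horiz_mkPt, mul_assoc, he', mul_one]
    have hn : nu (cornerInv σ τ e y) = (3 - σ) / 2 + σ * y 0 := by
      rw [nu_rotate he, hc, Real.sq_sqrt h1.le]; ring
    refine ⟨?_, ?_, ?_⟩
    · rw [hc]; exact Real.sqrt_pos.2 h1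
    · rw [hn]
      have : σ * ((3 - σ) / 2 + σ * y 0 - (3 - σ) / 2) = y 0 := by linear_combination y 0 * hσ
      rw [this]; exact h2
    · have : τ * ((1 - τ) / 2 + τ * y 2 - (1 - τ) / 2) = y 2 := by linear_combination y 2 * hτ
      change τ * ((1 - τ) / 2 + τ * y 2 - (1 - τ) / 2) < 1
      rw [this]; exact h3
  left_inv' q hq := by
    obtain ⟨h1, h2, h3⟩ := hq
    have hn := nu_rotate he q
    have : (3 - σ) / 2 + σ * (σ * (nu q - (3 - σ) / 2)) - ((horiz q * e).im + 10 - 10) ^ 2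
        = (horiz q * e).re ^ 2 := by linear_combination (nu q - (3 - σ) / 2) * hσ + hn
    refine ext_horiz ?_ ?_
    · change ⟨√((3 - σ) / 2 + σ * (σ * (nu q - (3 - σ) / 2)) - ((horiz q * e).im + 10 - 10) ^ 2),
        (horiz q * e).im + 10 - 10⟩ * (starRingEnd ℂ) e = _
      rw [this, Real.sqrt_sq h1.le, add_sub_cancel_right, Complex.eta, mul_assoc, he, mul_one]
    · change (1 - τ) / 2 + τ * (τ * (q 2 - (1 - τ) / 2)) = q 2
      linear_combination (q 2 - (1 - τ) / 2) * hτ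
  right_inv' y hy := by
    obtain ⟨h1, h2, h3⟩ := hy
    have he' : (starRingEnd ℂ) e * e = 1 := by rw [mul_comm]; exact he
    have hc : horiz (cornerInv σ τ e y) * e =
        ⟨√((3 - σ) / 2 + σ * y 0 - (y 1 - 10) ^ 2), y 1 - 10⟩ := by
      rw [cornerInv, horiz_mkPt, mul_assoc, he', mul_one]
    have hn : nu (cornerInv σ τ e y) = (3 - σ) / 2 + σ * y 0 := by
      rw [nu_rotate he, hc, Real.sq_sqrt h1.le]; ring
    ext i
    fin_cases i
    · change σ * (nu (cornerInv σ τ e y) - (3 - σ) / 2) = y 0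
      rw [hn]; linear_combination y 0 * hσ
    · change (horiz (cornerInv σ τ e y) * e).im + 10 = y 1
      rw [hc]; ring
    · change τ * ((1 - τ) / 2 + τ * y 2 - (1 - τ) / 2) = y 2
      linear_combination y 2 * hτ
  open_source := isOpen_cornerSource
  open_target := isOpen_cornerTarget
  continuousOn_toFun := contDiff_cornerMap.continuous.continuousOn
  continuousOn_invFun := contDiffOn_cornerInv.continuousOn

theorem sign_cases {s : ℝ} (h : s * s = 1) : s = 1 ∨ s = -1 := mul_self_eq_one_iff.1 h

/-- The bounds by 1 in the source cut off the lateral and the horizontal face opposite to the chosen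
ones, so there membership in the body is decided by the two signed distances. -/
theorem isOrthantChart_cornerChart (hσ : σ * σ = 1) (hτ : τ * τ = 1)
    (he : e * (starRingEnd ℂ) e = 1) : IsOrthantChart body (cornerChart σ τ e hσ hτ he) where
  smooth := contDiff_cornerMap.contDiffOn
  smooth_symm := contDiffOn_cornerInv
  isImage := by
    intro q hq
    obtain ⟨h1, h2, h3⟩ : q ∈ cornerSource σ τ e := hq
    have hn := nu_rotate he q
    change cornerMap σ τ e q ∈ orthant ↔ q ∈ body
    constructor
    · intro h
      have h0 : 0 ≤ σ * (nu q - (3 - σ) / 2) := h 0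
      have h4 : 0 ≤ τ * (q 2 - (1 - τ) / 2) := h 2
      rcases sign_cases hσ with rfl | rfl <;> rcases sign_cases hτ with rfl | rfl <;>
        exact ⟨⟨by linarith, by linarith⟩, by linarith, by linarith⟩
    · rintro ⟨⟨a1, a2⟩, a3, a4⟩ i
      fin_cases i
      · change 0 ≤ σ * (nu q - (3 - σ) / 2)
        rcases sign_cases hσ with rfl | rfl <;> linarith
      -- On the body the imaginary part is at most √2 in absolute value, so the shift by 10 keeps
      -- the tangential coordinate away from the faces of the orthant.
      · change 0 ≤ (horiz q * e).im + 10
        nlinarith [sq_nonneg (horiz q * e).re]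
      · change 0 ≤ τ * (q 2 - (1 - τ) / 2)
        rcases sign_cases hτ with rfl | rfl <;> linarith

end corner

/-! ### Derivatives of chart coordinates along the field -/

theorem fderiv_component {f : E3 → E3} {p v : E3} {i : Fin 3} {d : ℝ} {c : ℝ → E3}
    (hf : DifferentiableAt ℝ f p) (hc : HasDerivAt c v 0) (h0 : c 0 = p)
    (h : HasDerivAt (fun t : ℝ => f (c t) i) d 0) : (fderiv ℝ f p v) i = d := by
  have h2 : HasFDerivAt f (fderiv ℝ f p) (c 0) := by rw [h0]; exact hf.hasFDerivAt
  have h3 := h2.comp_hasDerivAt (0 : ℝ) hc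
  have h4 := (EuclideanSpace.proj (𝕜 := ℝ) i).hasFDerivAt.comp_hasDerivAt (0 : ℝ) h3
  exact h4.unique h

theorem hasDerivAt_line (p v : E3) : HasDerivAt (fun t : ℝ => p + t • v) v 0 := by
  simpa using ((hasDerivAt_id (0 : ℝ)).smul_const v).const_add p

theorem cornerMap_fderiv_zero (σ τ : ℝ) (e : ℂ) (q : E3) :
    (fderiv ℝ (cornerMap σ τ e) q (vfield q)) 0 = σ * (2 * nu q * expand q) := by
  refine fderiv_component (contDiff_cornerMap.differentiable (by simp) q)
    (hasDerivAt_line q (vfield q)) (by simp) ?_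
  change HasDerivAt (fun t : ℝ => σ * ((q 0 + t * vfield q 0) ^ 2 + (q 1 + t * vfield q 1) ^ 2
    - (3 - σ) / 2)) _ 0
  have h (i : Fin 3) : HasDerivAt (fun t : ℝ => q i + t * vfield q i) (vfield q i) 0 := by
    simpa using ((hasDerivAt_id (0 : ℝ)).mul_const (vfield q i)).const_add (q i)
  have := (((h 0).pow 2).add ((h 1).pow 2)).sub_const ((3 - σ) / 2) |>.const_mul σ
  refine HasDerivAt.congr_deriv this ?_
  simp only [vfield_zero, vfield_one, nu]
  ring

theorem cornerMap_fderiv_two (σ τ : ℝ) (e : ℂ) (q : E3) :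
    (fderiv ℝ (cornerMap σ τ e) q (vfield q)) 2 = τ * fieldZ (rad q) (q 2) := by
  refine fderiv_component (contDiff_cornerMap.differentiable (by simp) q)
    (hasDerivAt_line q (vfield q)) (by simp) ?_
  change HasDerivAt (fun t : ℝ => τ * ((q 2 + t * vfield q 2) - (1 - τ) / 2)) _ 0
  simpa using ((((hasDerivAt_id (0 : ℝ)).mul_const (vfield q 2)).const_add (q 2)).sub_const
    ((1 - τ) / 2)).const_mul τ

theorem isOuter_of_lateral {q : E3} (h : nu q = 1 ∨ nu q = 2) : IsOuter (rad q) (q 2) := by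
  apply isOuter_of_abs
  unfold rad
  rcases h with h | h <;> rw [h] <;> norm_num [abs_of_nonneg, abs_of_neg]

theorem isOuter_of_horizontal {q : E3} (h : q 2 = 0 ∨ q 2 = 1) : IsOuter (rad q) (q 2) := by
  rcases h with h | h
  · exact isOuter_of_le (by rw [h]; norm_num)
  · exact isOuter_of_ge h.ge

theorem expand_eq_zero {q : E3} (h : IsOuter (rad q) (q 2)) : expand q = 0 := by
  simp [expand, h.fieldX]

theorem exists_unit_rotation {q : E3} (hq : 0 < nu q) :
    ∃ e : ℂ, e * (starRingEnd ℂ) e = 1 ∧ (horiz q * e).im = 0 ∧ 0 < (horiz q * e).re := by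
  have hn : 0 < ‖horiz q‖ := by
    rw [nu_eq] at hq
    exact (norm_nonneg _).lt_of_ne fun h => by simp [← h] at hq
  have h0 : (‖horiz q‖ : ℂ) ≠ 0 := by exact_mod_cast hn.ne'
  have h1 : horiz q * (starRingEnd ℂ) (horiz q) = (‖horiz q‖ : ℂ) ^ 2 := by
    rw [Complex.mul_conj, Complex.normSq_eq_norm_sq]; push_cast; rfl
  have h2 : horiz q * ((starRingEnd ℂ) (horiz q) / ‖horiz q‖) = (‖horiz q‖ : ℂ) := by
    rw [← mul_div_assoc, h1]; field_simp
  refine ⟨(starRingEnd ℂ) (horiz q) / ‖horiz q‖, ?_, ?_, ?_⟩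
  · rw [map_div₀, Complex.conj_conj, Complex.conj_ofReal, div_mul_div_comm, mul_comm, h1]
    field_simp
  · rw [h2]; simp
  · rw [h2]; simpa using hn

/-- Around each point of the body there is a corner chart. -/
theorem exists_cornerChart {q : E3} (hq : q ∈ body) : ∃ (σ τ : ℝ) (e : ℂ) (hσ : σ * σ = 1)
    (hτ : τ * τ = 1) (he : e * (starRingEnd ℂ) e = 1),
    q ∈ (cornerChart σ τ e hσ hτ he).source ∧ cornerMap σ τ e q 1 = 10 ∧
    (q 2 = 0 → τ = 1) ∧ (q 2 = 1 → τ = -1) := by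
  obtain ⟨e, he, him, hre⟩ := exists_unit_rotation (body_nu_pos hq)
  obtain ⟨⟨a1, a2⟩, a3, a4⟩ := hq
  obtain ⟨σ, hσ, h1⟩ : ∃ σ : ℝ, σ * σ = 1 ∧ σ * (nu q - (3 - σ) / 2) < 1 := by
    by_cases h : nu q < 2
    · exact ⟨1, by norm_num, by linarith⟩
    · exact ⟨-1, by norm_num, by linarith⟩
  obtain ⟨τ, hτ, h2, h3, h4⟩ : ∃ τ : ℝ, τ * τ = 1 ∧ τ * (q 2 - (1 - τ) / 2) < 1 ∧
      (q 2 = 0 → τ = 1) ∧ (q 2 = 1 → τ = -1) := by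
    by_cases h : q 2 < 1
    · exact ⟨1, by norm_num, by linarith, fun _ => rfl, fun h' => absurd h' h.ne⟩
    · exact ⟨-1, by norm_num, by linarith, fun h' => by linarith, fun _ => rfl⟩
  refine ⟨σ, τ, e, hσ, hτ, he, ⟨hre, h1, h2⟩, ?_, h3, h4⟩
  change (horiz q * e).im + 10 = 10
  rw [him]; norm_num

theorem cornerMap_zero_pos {σ τ : ℝ} {e : ℂ} {q : E3} (hσ : σ * σ = 1) (h1 : 1 < nu q)
    (h2 : nu q < 2) : 0 < cornerMap σ τ e q 0 := by
  change 0 < σ * (nu q - (3 - σ) / 2)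
  rcases sign_cases hσ with rfl | rfl <;> linarith

theorem cornerMap_two_pos {σ τ : ℝ} {e : ℂ} {q : E3} (hτ : τ * τ = 1) (h1 : 0 < q 2)
    (h2 : q 2 < 1) : 0 < cornerMap σ τ e q 2 := by
  change 0 < τ * (q 2 - (1 - τ) / 2)
  rcases sign_cases hτ with rfl | rfl <;> linarith

theorem cornerMap_zero_eq {σ τ : ℝ} {e : ℂ} {q : E3} (hσ : σ * σ = 1)
    (hs : q ∈ cornerSource σ τ e) (h : nu q = 1 ∨ nu q = 2) : cornerMap σ τ e q 0 = 0 := by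
  have := hs.2.1
  change σ * (nu q - (3 - σ) / 2) = 0
  rcases h with h | h <;> rw [h] at this ⊢ <;> rcases sign_cases hσ with rfl | rfl <;> linarith

theorem lateral_of_cornerMap {σ τ : ℝ} {e : ℂ} {q : E3} (hσ : σ * σ = 1)
    (h : cornerMap σ τ e q 0 = 0) : nu q = 1 ∨ nu q = 2 := by
  change σ * (nu q - (3 - σ) / 2) = 0 at h
  rcases sign_cases hσ with rfl | rfl
  · left; linarith
  · right; linarith

theorem isOrthantDomain_body : IsOrthantDomain body := fun _ hp => by
  obtain ⟨σ, τ, e, hσ, hτ, he, h, -⟩ := exists_cornerChart hp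
  exact ⟨_, isOrthantChart_cornerChart hσ hτ he, h⟩

theorem isTransverseIn_bottom {p : E3} (h : 1 < nu p ∧ nu p < 2) (h2 : p 2 = 0) :
    IsTransverseIn vfield body p := by
  have hp : p ∈ body := ⟨⟨h.1.le, h.2.le⟩, h2.ge, by rw [h2]; norm_num⟩
  obtain ⟨σ, τ, e, hσ, hτ, he, hs, h1, hτ0, -⟩ := exists_cornerChart hp
  have ht := hτ0 h2
  refine ⟨_, isOrthantChart_cornerChart hσ hτ he, hs, 2, ?_, ?_, ?_⟩
  · change τ * (p 2 - (1 - τ) / 2) = 0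
    rw [h2, ht]; norm_num
  · intro j hj
    fin_cases j
    · exact cornerMap_zero_pos hσ h.1 h.2
    · change 0 < cornerMap σ τ e p 1; rw [h1]; norm_num
    · exact absurd rfl hj
  · change 0 < (fderiv ℝ (cornerMap σ τ e) p (vfield p)) 2
    rw [cornerMap_fderiv_two, (isOuter_of_horizontal (Or.inl h2)).fieldZ, ht]; norm_num

theorem isTransverseOut_top {p : E3} (h : 1 < nu p ∧ nu p < 2) (h2 : p 2 = 1) :
    IsTransverseOut vfield body p := by
  have hp : p ∈ body := ⟨⟨h.1.le, h.2.le⟩, by rw [h2]; norm_num, h2.le⟩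
  obtain ⟨σ, τ, e, hσ, hτ, he, hs, h1, -, hτ1⟩ := exists_cornerChart hp
  have ht := hτ1 h2
  refine ⟨_, isOrthantChart_cornerChart hσ hτ he, hs, 2, ?_, ?_, ?_⟩
  · change τ * (p 2 - (1 - τ) / 2) = 0
    rw [h2, ht]; norm_num
  · intro j hj
    fin_cases j
    · exact cornerMap_zero_pos hσ h.1 h.2
    · change 0 < cornerMap σ τ e p 1; rw [h1]; norm_num
    · exact absurd rfl hj
  · change (fderiv ℝ (cornerMap σ τ e) p (vfield p)) 2 < 0
    rw [cornerMap_fderiv_two, (isOuter_of_horizontal (Or.inr h2)).fieldZ, ht]; norm_num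

theorem tangent_lateral (σ τ : ℝ) (e : ℂ) (hσ : σ * σ = 1) (q : E3)
    (h : cornerMap σ τ e q 0 = 0) : (fderiv ℝ (cornerMap σ τ e) q (vfield q)) 0 = 0 := by
  rw [cornerMap_fderiv_zero, expand_eq_zero (isOuter_of_lateral (lateral_of_cornerMap hσ h))]
  simp

theorem isParallel_lateral {p : E3} (h : nu p = 1 ∨ nu p = 2) (h2 : 0 < p 2 ∧ p 2 < 1) :
    IsParallel vfield body p := by
  have hp : p ∈ body := ⟨by rcases h with h | h <;> rw [h] <;> norm_num, h2.1.le, h2.2.le⟩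
  obtain ⟨σ, τ, e, hσ, hτ, he, hs, h1, -⟩ := exists_cornerChart hp
  refine ⟨_, isOrthantChart_cornerChart hσ hτ he, hs, 0, cornerMap_zero_eq hσ hs h, ?_,
    fun q _ _ hq0 => tangent_lateral σ τ e hσ q hq0⟩
  intro j hj
  fin_cases j
  · exact absurd rfl hj
  · change 0 < cornerMap σ τ e p 1; rw [h1]; norm_num
  · exact cornerMap_two_pos hτ h2.1 h2.2

theorem isCornerSeparation_edge {p : E3} (h : nu p = 1 ∨ nu p = 2) (h2 : p 2 = 0 ∨ p 2 = 1) :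
    IsCornerSeparation vfield body p := by
  have hp : p ∈ body := ⟨by rcases h with h | h <;> rw [h] <;> norm_num,
    by rcases h2 with h2 | h2 <;> rw [h2] <;> norm_num⟩
  obtain ⟨σ, τ, e, hσ, hτ, he, hs, h1, hτ0, hτ1⟩ := exists_cornerChart hp
  refine ⟨_, isOrthantChart_cornerChart hσ hτ he, hs, 0, 2, by decide, cornerMap_zero_eq hσ hs h,
    ?_, ?_, fun q _ _ hq0 => tangent_lateral σ τ e hσ q hq0, ?_⟩
  · change τ * (p 2 - (1 - τ) / 2) = 0
    rcases h2 with h2 | h2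
    · rw [h2, hτ0 h2]; norm_num
    · rw [h2, hτ1 h2]; norm_num
  · intro k hk0 hk2
    fin_cases k
    · exact absurd rfl hk0
    · change 0 < cornerMap σ τ e p 1; rw [h1]; norm_num
    · exact absurd rfl hk2
  · change (fderiv ℝ (cornerMap σ τ e) p (vfield p)) 2 ≠ 0
    rw [cornerMap_fderiv_two, (isOuter_of_horizontal h2).fieldZ, mul_one]
    rintro rfl
    norm_num at hτ

theorem isOpen_core : IsOpen {q : E3 | (1 < nu q ∧ nu q < 2) ∧ 0 < q 2 ∧ q 2 < 1} := by
  have h2 : Continuous fun q : E3 => q 2 := (contDiff_coord 2).continuous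
  exact ((isOpen_lt continuous_const continuous_nu).inter
    (isOpen_lt continuous_nu continuous_const)).inter
    ((isOpen_lt continuous_const h2).inter (isOpen_lt h2 continuous_const))

theorem core_subset_interior :
    {q : E3 | (1 < nu q ∧ nu q < 2) ∧ 0 < q 2 ∧ q 2 < 1} ⊆ interior body :=
  interior_maximal (fun _ hq => ⟨⟨hq.1.1.le, hq.1.2.le⟩, hq.2.1.le, hq.2.2.le⟩) isOpen_core

theorem frontier_body_cases {p : E3} (hp : p ∈ frontier body) :
    p ∈ body ∧ ((nu p = 1 ∨ nu p = 2) ∨ (p 2 = 0 ∨ p 2 = 1)) := by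
  have hb := isClosed_body.frontier_subset hp
  refine ⟨hb, ?_⟩
  by_contra! h
  obtain ⟨⟨a1, a2⟩, a3, a4⟩ := hb
  refine hp.2 (core_subset_interior ⟨⟨?_, ?_⟩, ?_, ?_⟩)
  · exact lt_of_le_of_ne a1 (Ne.symm h.1.1)
  · exact lt_of_le_of_ne a2 h.1.2
  · exact lt_of_le_of_ne a3 (Ne.symm h.2.1)
  · exact lt_of_le_of_ne a4 h.2.2

theorem boundary_cases {p : E3} (hp : p ∈ frontier body) :
    IsTransverseIn vfield body p ∨ IsTransverseOut vfield body p ∨ IsParallel vfield body p ∨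
      IsCornerSeparation vfield body p := by
  obtain ⟨⟨⟨a1, a2⟩, a3, a4⟩, h⟩ := frontier_body_cases hp
  by_cases hl : nu p = 1 ∨ nu p = 2
  · by_cases hz : p 2 = 0 ∨ p 2 = 1
    · exact Or.inr (Or.inr (Or.inr (isCornerSeparation_edge hl hz)))
    · push Not at hz
      exact Or.inr (Or.inr (Or.inl (isParallel_lateral hl
        ⟨lt_of_le_of_ne a3 (Ne.symm hz.1), lt_of_le_of_ne a4 hz.2⟩)))
  · have hz := h.resolve_left hl
    push Not at hl
    have hn : 1 < nu p ∧ nu p < 2 := ⟨lt_of_le_of_ne a1 (Ne.symm hl.1), lt_of_le_of_ne a2 hl.2⟩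
    rcases hz with hz | hz
    · exact Or.inl (isTransverseIn_bottom hn hz)
    · exact Or.inr (Or.inl (isTransverseOut_top hn hz))

/-! ### Arbitrary charts -/

/-- Chart coordinates are nonnegative on P, so one that vanishes at the start of a curve in P has
nonnegative forward difference quotients. This constrains every chart, not only the corner charts.
-/
theorem IsOrthantChart.deriv_nonneg {P : Set E3} {φ : OpenPartialHomeomorph E3 E3}
    (hφ : IsOrthantChart P φ) {p v : E3} (hp : p ∈ φ.source) {i : Fin 3} (hi : φ p i = 0)
    {c : ℝ → E3} (hc : HasDerivAt c v 0) (h0 : c 0 = p)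
    (hP : ∀ᶠ t in nhdsWithin (0 : ℝ) (Set.Ioi 0), c t ∈ P) : 0 ≤ (fderiv ℝ φ p v) i := by
  have hd : DifferentiableAt ℝ φ p :=
    (hφ.smooth.contDiffAt (φ.open_source.mem_nhds hp)).differentiableAt (by simp)
  have h2 : HasFDerivAt φ (fderiv ℝ φ p) (c 0) := by rw [h0]; exact hd.hasFDerivAt
  have h3 := h2.comp_hasDerivAt (0 : ℝ) hc
  have h4 := (EuclideanSpace.proj (𝕜 := ℝ) i).hasFDerivAt.comp_hasDerivAt (0 : ℝ) h3
  have h5 := (hasDerivWithinAt_iff_tendsto_slope' (Set.self_notMem_Ioi)).1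
    (h4.hasDerivWithinAt (s := Set.Ioi 0))
  have hs : ∀ᶠ t in nhdsWithin (0 : ℝ) (Set.Ioi 0), c t ∈ φ.source := by
    refine nhdsWithin_le_nhds (hc.continuousAt.eventually_mem ?_)
    rw [h0]; exact φ.open_source.mem_nhds hp
  refine ge_of_tendsto h5 ?_
  filter_upwards [hs, hP, self_mem_nhdsWithin] with t ht1 ht2 ht3
  have ht4 : 0 ≤ φ (c t) i := (hφ.isImage ht1).2 ht2 i
  have ht5 : (0 : ℝ) < t := ht3
  rw [slope_def_field]
  have : (EuclideanSpace.proj i : E3 →L[ℝ] ℝ) (φ (c 0)) = 0 := by rw [h0]; exact hi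
  refine div_nonneg ?_ (by linarith)
  change 0 ≤ φ (c t) i - (EuclideanSpace.proj i : E3 →L[ℝ] ℝ) (φ (c 0))
  rw [this]; linarith

theorem IsOrthantChart.deriv_nonpos {P : Set E3} {φ : OpenPartialHomeomorph E3 E3}
    (hφ : IsOrthantChart P φ) {p v : E3} (hp : p ∈ φ.source) {i : Fin 3} (hi : φ p i = 0)
    {c : ℝ → E3} (hc : HasDerivAt c v 0) (h0 : c 0 = p)
    (hP : ∀ᶠ t in nhdsWithin (0 : ℝ) (Set.Iio 0), c t ∈ P) : (fderiv ℝ φ p v) i ≤ 0 := by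
  have hc' : HasDerivAt (fun t => c (-t)) (-v) 0 := by
    have : HasDerivAt c v (-0) := by simpa using hc
    exact (this.scomp (0 : ℝ) (hasDerivAt_neg (0 : ℝ))).congr_deriv (by simp)
  have hP' : ∀ᶠ t in nhdsWithin (0 : ℝ) (Set.Ioi 0), c (-t) ∈ P := by
    have : Filter.Tendsto (fun t : ℝ => -t) (nhdsWithin 0 (Set.Ioi 0))
        (nhdsWithin 0 (Set.Iio 0)) := by
      simpa using tendsto_neg_nhdsGT (a := (0 : ℝ))
    exact this.eventually hP
  have := hφ.deriv_nonneg hp hi hc' (by simpa using h0) hP'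
  rw [map_neg] at this
  have h : 0 ≤ -(fderiv ℝ φ p v) i := this
  linarith

theorem IsOrthantChart.exists_deriv_ne {P : Set E3} {φ : OpenPartialHomeomorph E3 E3}
    (hφ : IsOrthantChart P φ) {p : E3} (hp : p ∈ φ.source) (i : Fin 3) :
    ∃ v, (fderiv ℝ φ p v) i ≠ 0 := by
  have hd : DifferentiableAt ℝ φ p :=
    (hφ.smooth.contDiffAt (φ.open_source.mem_nhds hp)).differentiableAt (by simp)
  have hd' : DifferentiableAt ℝ φ.symm (φ p) :=
    (hφ.smooth_symm.contDiffAt (φ.open_target.mem_nhds (φ.map_source hp))).differentiableAt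
      (by simp)
  have h2 : HasFDerivAt φ (fderiv ℝ φ p) (φ.symm (φ p)) := by
    rw [φ.left_inv hp]; exact hd.hasFDerivAt
  have h3 := h2.comp (φ p) hd'.hasFDerivAt
  have h4 : HasFDerivAt (φ ∘ φ.symm) (ContinuousLinearMap.id ℝ E3) (φ p) := by
    refine (hasFDerivAt_id _).congr_of_eventuallyEq ?_
    filter_upwards [φ.open_target.mem_nhds (φ.map_source hp)] with y hy using φ.right_inv hy
  have h5 := h3.unique h4
  refine ⟨fderiv ℝ φ.symm (φ p) (EuclideanSpace.single i 1), ?_⟩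
  have := congrArg (fun f : E3 →L[ℝ] E3 => f (EuclideanSpace.single i 1) i) h5
  simp at this
  rw [this]; norm_num

theorem mem_of_chart {P : Set E3} {φ : OpenPartialHomeomorph E3 E3}
    (hφ : IsOrthantChart P φ) {p : E3} (hp : p ∈ φ.source) {i : Fin 3} (hi : φ p i = 0)
    (h : ∀ j, j ≠ i → 0 < φ p j) : p ∈ P := by
  refine (hφ.isImage hp).1 fun j => ?_
  by_cases hj : j = i
  · rw [hj, hi]
  · exact (h j hj).le

/-- Through each point of the body there is a curve tangent to the field which stays in the body
on the sides where the trajectory does. -/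
theorem exists_tangent_curve {p : E3} (hp : p ∈ body) : ∃ c : ℝ → E3, c 0 = p ∧
    HasDerivAt c (vfield p) 0 ∧
    (0 < p 2 → ∀ᶠ t in nhdsWithin (0 : ℝ) (Set.Iio 0), c t ∈ body) ∧
    (p 2 < 1 → ∀ᶠ t in nhdsWithin (0 : ℝ) (Set.Ioi 0), c t ∈ body) := by
  obtain ⟨⟨a1, a2⟩, a3, a4⟩ := hp
  by_cases hl : nu p = 1 ∨ nu p = 2
  · have ho := isOuter_of_lateral hl
    -- A straight line with a horizontal component tangent to the outer cylinder leaves the body, so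
    -- on the lateral faces a helix is used, along which ν is constant.
    refine ⟨fun t => mkPt (horiz p * Complex.exp (t * speed p * Complex.I)) (p 2 + t), by simp,
      ?_, ?_, ?_⟩
    · have h1 : HasDerivAt (fun t : ℝ => (t : ℂ) * speed p * Complex.I) (speed p * Complex.I) 0 := by
        simpa using ((Complex.ofRealCLM.hasDerivAt (x := (0 : ℝ))).mul_const
          (speed p : ℂ)).mul_const Complex.I
      have h2 := HasDerivAt.mkPt (h1.cexp.const_mul (horiz p)) ((hasDerivAt_id (0 : ℝ)).const_add (p 2))
      refine HasDerivAt.congr_deriv h2 ?_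
      rw [vfield, expand_eq_zero ho, ho.fieldZ]
      simp [mul_comm]
    all_goals
      have hnu (t : ℝ) :
          nu (mkPt (horiz p * Complex.exp (t * speed p * Complex.I)) (p 2 + t)) = nu p := by
        rw [nu_mkPt, norm_mul, ← Complex.ofReal_mul, Complex.norm_exp_ofReal_mul_I, mul_one, nu_eq]
      intro hz
    · filter_upwards [self_mem_nhdsWithin, nhdsWithin_le_nhds (lt_mem_nhds (neg_lt_zero.2 hz))]
        with t ht ht'
      have ht0 : t < 0 := ht
      refine ⟨by rw [hnu]; exact ⟨a1, a2⟩, ?_, ?_⟩ <;> rw [mkPt_two] <;> linarith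
    · filter_upwards [self_mem_nhdsWithin, nhdsWithin_le_nhds (gt_mem_nhds (sub_pos.2 hz))]
        with t ht ht'
      have ht0 : 0 < t := ht
      refine ⟨by rw [hnu]; exact ⟨a1, a2⟩, ?_, ?_⟩ <;> rw [mkPt_two] <;> linarith
  · push Not at hl
    have b1 := lt_of_le_of_ne a1 (Ne.symm hl.1)
    have b2 := lt_of_le_of_ne a2 hl.2
    have hline := hasDerivAt_line p (vfield p)
    have hcont := hline.continuousAt
    have hz2 (t : ℝ) : (p + t • vfield p) 2 = p 2 + t * fieldZ (rad p) (p 2) := rfl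
    have hn1 : ∀ᶠ t in nhds (0 : ℝ), 1 < nu (p + t • vfield p) ∧ nu (p + t • vfield p) < 2 := by
      have : ContinuousAt (fun t : ℝ => nu (p + t • vfield p)) 0 :=
        continuous_nu.continuousAt.comp hcont
      exact (this.eventually_const_lt (by simpa using b1)).and
        (this.eventually_lt_const (by simpa using b2))
    have hc2 : ContinuousAt (fun t : ℝ => (p + t • vfield p) 2) 0 :=
      (contDiff_coord 2).continuous.continuousAt.comp hcont
    have hF := fieldZ_nonneg (rad p) (p 2)
    refine ⟨_, by simp, hline, ?_, ?_⟩
    · intro hz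
      have hlo : ∀ᶠ t in nhds (0 : ℝ), 0 < (p + t • vfield p) 2 :=
        hc2.eventually_const_lt (by simpa using hz)
      filter_upwards [self_mem_nhdsWithin, nhdsWithin_le_nhds hlo, nhdsWithin_le_nhds hn1]
        with t ht h1 h2
      have ht0 : t < 0 := ht
      refine ⟨⟨h2.1.le, h2.2.le⟩, h1.le, ?_⟩
      rw [hz2]; nlinarith
    · intro hz
      have hlo : ∀ᶠ t in nhds (0 : ℝ), (p + t • vfield p) 2 < 1 :=
        hc2.eventually_lt_const (by simpa using hz)
      filter_upwards [self_mem_nhdsWithin, nhdsWithin_le_nhds hlo, nhdsWithin_le_nhds hn1]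
        with t ht h1 h2
      have ht0 : 0 < t := ht
      refine ⟨⟨h2.1.le, h2.2.le⟩, ?_, h1.le⟩
      rw [hz2]; nlinarith

/-- Above height 0 the tangent curve lies in the body for small negative times. The vanishing
coordinate then has a nonpositive derivative along the field, whatever the chart. -/
theorem IsTransverseIn.bottom {p : E3} (h : IsTransverseIn vfield body p) : p ∈ body ∧ p 2 = 0 := by
  obtain ⟨φ, hφ, hs, i, hi, hj, hV⟩ := h
  have hp := mem_of_chart hφ hs hi hj
  refine ⟨hp, ?_⟩
  by_contra hz
  obtain ⟨c, h0, hc, hb, -⟩ := exists_tangent_curve hp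
  have := hφ.deriv_nonpos hs hi hc h0 (hb (lt_of_le_of_ne hp.2.1 (Ne.symm hz)))
  linarith

theorem IsTransverseOut.top {p : E3} (h : IsTransverseOut vfield body p) : p ∈ body ∧ p 2 = 1 := by
  obtain ⟨φ, hφ, hs, i, hi, hj, hV⟩ := h
  have hp := mem_of_chart hφ hs hi hj
  refine ⟨hp, ?_⟩
  by_contra hz
  obtain ⟨c, h0, hc, -, hb⟩ := exists_tangent_curve hp
  have := hφ.deriv_nonneg hs hi hc h0 (hb (lt_of_le_of_ne hp.2.2 hz))
  linarith

/-- Off the lateral faces the differential of the vanishing coordinate would be zero, which is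
impossible for a diffeomorphism: it kills each direction in which the body extends both ways and, by
hypothesis, the field, which on a horizontal face supplies the missing transverse direction. -/
theorem IsParallel.lateral {p : E3} (h : IsParallel vfield body p) :
    p ∈ body ∧ (nu p = 1 ∨ nu p = 2) := by
  obtain ⟨φ, hφ, hs, i, hi, hj, hV⟩ := h
  have hp := mem_of_chart hφ hs hi hj
  refine ⟨hp, ?_⟩
  by_contra! hl
  obtain ⟨⟨a1, a2⟩, a3, a4⟩ := id hp
  have b1 := lt_of_le_of_ne a1 (Ne.symm hl.1)
  have b2 := lt_of_le_of_ne a2 hl.2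
  have hV0 := hV p hs hp hi
  obtain ⟨u, hu⟩ := hφ.exists_deriv_ne hs i
  have hn1 (v : E3) : ∀ᶠ t in nhds (0 : ℝ), 1 < nu (p + t • v) ∧ nu (p + t • v) < 2 := by
    have : ContinuousAt (fun t : ℝ => nu (p + t • v)) 0 :=
      continuous_nu.continuousAt.comp (hasDerivAt_line p v).continuousAt
    exact (this.eventually_const_lt (by simpa using b1)).and
      (this.eventually_lt_const (by simpa using b2))
  have key (v : E3) (hv : ∀ᶠ t in nhds (0 : ℝ), 0 ≤ (p + t • v) 2 ∧ (p + t • v) 2 ≤ 1) :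
      (fderiv ℝ φ p v) i = 0 := by
    have hb : ∀ᶠ t in nhds (0 : ℝ), p + t • v ∈ body := by
      filter_upwards [hv, hn1 v] with t h1 h2
      exact ⟨⟨h2.1.le, h2.2.le⟩, h1⟩
    exact le_antisymm
      (hφ.deriv_nonpos hs hi (hasDerivAt_line p v) (by simp) (nhdsWithin_le_nhds hb))
      (hφ.deriv_nonneg hs hi (hasDerivAt_line p v) (by simp) (nhdsWithin_le_nhds hb))
  have hflat (v : E3) (hv : v 2 = 0) : (fderiv ℝ φ p v) i = 0 := by
    refine key v (Filter.Eventually.of_forall fun t => ?_)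
    have : (p + t • v) 2 = p 2 + t * v 2 := rfl
    rw [this, hv, mul_zero, add_zero]
    exact ⟨a3, a4⟩
  by_cases hz : p 2 = 0 ∨ p 2 = 1
  -- On a horizontal face the field has vertical component 1, so this combination is horizontal.
  · have h1 := hflat (u - u 2 • vfield p) (by
      have : (u - u 2 • vfield p) 2 = u 2 - u 2 * vfield p 2 := rfl
      rw [this, vfield_two, (isOuter_of_horizontal hz).fieldZ]; ring)
    rw [map_sub, map_smul] at h1
    have h2 : (fderiv ℝ φ p u) i - u 2 * (fderiv ℝ φ p (vfield p)) i = 0 := h1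
    rw [hV0, mul_zero, sub_zero] at h2
    exact hu h2
  · push Not at hz
    refine hu (key u ?_)
    have : ContinuousAt (fun t : ℝ => (p + t • u) 2) 0 :=
      (contDiff_coord 2).continuous.continuousAt.comp (hasDerivAt_line p u).continuousAt
    filter_upwards [this.eventually_const_lt (u := 0)
      (by simpa using lt_of_le_of_ne a3 (Ne.symm hz.1)),
      this.eventually_lt_const (u := 1) (by simpa using lt_of_le_of_ne a4 hz.2)] with t h1 h2
    exact ⟨h1.le, h2.le⟩

/-! ### Entry and exit regions -/

theorem mem_closure_face {p : E3} (hp : p ∈ body) :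
    p ∈ closure {q : E3 | (1 < nu q ∧ nu q < 2) ∧ q 2 = p 2} := by
  have hr : 1 ≤ ‖horiz p‖ ∧ ‖horiz p‖ ≤ √2 := by rw [body_eq] at hp; exact hp.1
  have h0 : 0 < ‖horiz p‖ := by linarith
  have h54 : (5 / 4 : ℝ) < √2 := by rw [Real.lt_sqrt] <;> norm_num
  -- The radius is moved linearly towards 5/4, a value strictly between 1 and √2, at fixed height
  -- and angle.
  let c : ℝ → E3 := fun t => mkPt (horiz p * (((1 - t) + t * (5 / 4 / ‖horiz p‖) : ℝ) : ℂ)) (p 2)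
  have hc : Continuous c := by
    refine Continuous.mkPt (continuous_const.mul (Complex.continuous_ofReal.comp ?_))
      continuous_const
    fun_prop
  have hlim : Filter.Tendsto c (nhdsWithin 0 (Set.Ioi 0)) (nhds p) := by
    have := (hc.tendsto 0).mono_left (nhdsWithin_le_nhds (s := Set.Ioi 0))
    simpa [c] using this
  refine mem_closure_of_tendsto hlim ?_
  filter_upwards [self_mem_nhdsWithin, nhdsWithin_le_nhds (gt_mem_nhds (zero_lt_one' ℝ))]
    with t ht ht1
  have ht0 : 0 < t := ht
  have hnorm : ‖horiz (c t)‖ = (1 - t) * ‖horiz p‖ + t * (5 / 4) := by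
    rw [horiz_mkPt, norm_mul, Complex.norm_real, Real.norm_of_nonneg]
    · field_simp
    · have : 0 ≤ t * (5 / 4 / ‖horiz p‖) := by positivity
      linarith
  have h1 : 1 < ‖horiz (c t)‖ := by rw [hnorm]; nlinarith
  have h2 : ‖horiz (c t)‖ < √2 := by rw [hnorm]; nlinarith
  refine ⟨⟨?_, ?_⟩, rfl⟩
  · rw [nu_eq]; nlinarith
  · rw [nu_eq, ← Real.lt_sqrt (norm_nonneg _)]; exact h2

theorem isClosed_face (z : ℝ) : IsClosed {q : E3 | q ∈ body ∧ q 2 = z} :=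
  isClosed_body.inter (isClosed_eq (contDiff_coord 2).continuous continuous_const)

theorem entryRegion_eq : entryRegion vfield body = {q | q ∈ body ∧ q 2 = 0} := by
  apply subset_antisymm
  · exact closure_minimal (fun p hp => IsTransverseIn.bottom hp) (isClosed_face 0)
  · rintro p ⟨hp, h2⟩
    refine closure_mono ?_ (mem_closure_face hp)
    rintro q ⟨hq, hq2⟩
    exact isTransverseIn_bottom hq (hq2.trans h2)

theorem exitRegion_eq : exitRegion vfield body = {q | q ∈ body ∧ q 2 = 1} := by
  apply subset_antisymm
  · exact closure_minimal (fun p hp => IsTransverseOut.top hp) (isClosed_face 1)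
  · rintro p ⟨hp, h2⟩
    refine closure_mono ?_ (mem_closure_face hp)
    rintro q ⟨hq, hq2⟩
    exact isTransverseOut_top hq (hq2.trans h2)

/-! ### Unit complex numbers -/

/-- The unit complex number in the direction of `w`. -/
def dir (w : ℂ) : ℂ := w / ‖w‖

theorem norm_dir {w : ℂ} (hw : w ≠ 0) : ‖dir w‖ = 1 := by
  rw [dir, norm_div, Complex.norm_real, norm_norm, div_self (norm_ne_zero_iff.2 hw)]

theorem norm_mul_dir (w : ℂ) : ‖w‖ * dir w = w := by
  rcases eq_or_ne w 0 with rfl | hw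
  · simp [dir]
  · have : (‖w‖ : ℂ) ≠ 0 := by exact_mod_cast norm_ne_zero_iff.2 hw
    rw [dir]; field_simp

theorem dir_mul_conj {w : ℂ} (hw : w ≠ 0) : dir w * (starRingEnd ℂ) (dir w) = 1 := by
  rw [Complex.mul_conj, Complex.normSq_eq_norm_sq, norm_dir hw]; norm_num

theorem dir_smul {r : ℝ} (hr : 0 < r) (w : ℂ) : dir (r * w) = dir w := by
  have : (r : ℂ) ≠ 0 := by exact_mod_cast hr.ne'
  rw [dir, dir, norm_mul, Complex.norm_real, Real.norm_of_nonneg hr.le]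
  push_cast
  rw [mul_div_mul_left _ _ this]

theorem dir_of_norm_eq_one {w : ℂ} (hw : ‖w‖ = 1) : dir w = w := by
  rw [dir, hw]; simp

theorem contDiffAt_dir {w : ℂ} (hw : w ≠ 0) : ContDiffAt ℝ ∞ dir w := by
  have h : ContDiffAt ℝ ∞ (fun w : ℂ => (‖w‖ : ℂ)) w :=
    Complex.ofRealCLM.contDiff.contDiffAt.comp w (contDiffAt_id.norm ℝ hw)
  exact contDiffAt_id.mul (h.inv (by exact_mod_cast norm_ne_zero_iff.2 hw))

/-- A unit complex number moves with logarithmic derivative i times its angular velocity. Working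
with `dir` in place of an angle avoids branches of the argument. -/
theorem HasDerivWithinAt.dir {w : ℝ → ℂ} {w' : ℂ} {s : Set ℝ} {t : ℝ}
    (h : HasDerivWithinAt w w' s t) (h0 : w t ≠ 0) :
    HasDerivWithinAt (fun t => dir (w t))
      (((((starRingEnd ℂ) (w t) * w').im / ‖w t‖ ^ 2 : ℝ) : ℂ) * Complex.I * dir (w t)) s t := by
  have hn : ‖w t‖ ≠ 0 := norm_ne_zero_iff.2 h0
  have h1 : HasDerivWithinAt (fun t => ‖w t‖) (inner ℝ (w t) w' / ‖w t‖) s t := by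
    have := (h.norm_sq).sqrt (by positivity)
    simp only [Real.sqrt_sq (norm_nonneg _)] at this
    exact this.congr_deriv (by field_simp)
  have h2 : HasDerivWithinAt (fun t => (‖w t‖ : ℂ)) ((inner ℝ (w t) w' / ‖w t‖ : ℝ) : ℂ) s t :=
    Complex.ofRealCLM.hasFDerivAt.comp_hasDerivWithinAt t h1
  have hn' : (‖w t‖ : ℂ) ≠ 0 := by exact_mod_cast hn
  refine (h.div h2 hn').congr_deriv ?_
  have hin : inner ℝ (w t) w' = ((starRingEnd ℂ) (w t) * w').re := by
    rw [Complex.inner, mul_comm]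
  have hsq : (starRingEnd ℂ) (w t) * w t = (‖w t‖ : ℂ) ^ 2 := by
    rw [mul_comm, Complex.mul_conj, Complex.normSq_eq_norm_sq]; push_cast; rfl
  have hdec := Complex.re_add_im ((starRingEnd ℂ) (w t) * w')
  rw [hin, DehnPlug.dir]
  generalize ((starRingEnd ℂ) (w t) * w').re = a at hdec ⊢
  generalize ((starRingEnd ℂ) (w t) * w').im = b at hdec ⊢
  push_cast
  field_simp
  linear_combination (-w') * hsq - w t * hdec

/-! ### The attaching map -/

/-- Position relative to the centre of the square, as a complex number. -/
def offset (r z : ℝ) : ℂ := ⟨r - 3 / 2, z - 1 / 2⟩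

/-- The attaching map. -/
def attachFun (y : E3) : E3 :=
  mkPt (horiz y / √‖horiz y‖ * dir (offset ‖horiz y‖ (y 2))) (y 2)

/-- The inverse of the attaching map. -/
def attachInv (q : E3) : E3 :=
  mkPt (horiz q * ‖horiz q‖ * (starRingEnd ℂ) (dir (offset (nu q) (q 2)))) (q 2)

theorem offset_ne_zero {r z : ℝ} (h : IsOuter (r - 3 / 2) z) : offset r z ≠ 0 := by
  intro h0
  have h1 : r - 3 / 2 = 0 := congrArg Complex.re h0
  have h2 : z - 1 / 2 = 0 := congrArg Complex.im h0
  have := h.1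
  rw [distA, h1, h2] at this
  norm_num at this

theorem norm_offset_sq (r z : ℝ) : ‖offset r z‖ ^ 2 = (r - 3 / 2) ^ 2 + (z - 1 / 2) ^ 2 := by
  rw [← Complex.normSq_eq_norm_sq, Complex.normSq_apply, offset]; ring

@[simp] theorem attachFun_two (y : E3) : attachFun y 2 = y 2 := rfl
@[simp] theorem attachInv_two (y : E3) : attachInv y 2 = y 2 := rfl

/-- Division by the square root of the radius turns radius r on the thick annulus into ν = r. Thus
the square of pairs (r, z) is identified with that of pairs (ν, z), and only the angle is changed.
-/
theorem nu_attachFun {y : E3} (h : offset ‖horiz y‖ (y 2) ≠ 0) : nu (attachFun y) = ‖horiz y‖ := by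
  rw [nu_eq, attachFun, horiz_mkPt, norm_mul, norm_dir h, mul_one, norm_div, Complex.norm_real,
    Real.norm_of_nonneg (Real.sqrt_nonneg _), div_pow, Real.sq_sqrt (norm_nonneg _), sq,
    mul_self_div_self]

theorem norm_attachInv {q : E3} (h : offset (nu q) (q 2) ≠ 0) :
    ‖horiz (attachInv q)‖ = nu q := by
  rw [attachInv, horiz_mkPt, norm_mul, Complex.norm_conj, norm_dir h, mul_one, norm_mul,
    Complex.norm_real, norm_norm, nu_eq, sq]

theorem attachInv_attachFun {y : E3} (h : offset ‖horiz y‖ (y 2) ≠ 0) :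
    attachInv (attachFun y) = y := by
  have hnu := nu_attachFun h
  have hn : ‖horiz (attachFun y)‖ = √‖horiz y‖ := by
    rw [← hnu, nu_eq, Real.sqrt_sq (norm_nonneg _)]
  refine ext_horiz ?_ rfl
  rw [attachInv, horiz_mkPt, hnu, hn, attachFun_two, attachFun, horiz_mkPt]
  have h1 := dir_mul_conj h
  rcases eq_or_ne (horiz y) 0 with h0 | h0
  · simp [h0]
  · have : (√‖horiz y‖ : ℂ) ≠ 0 := by
      have := Real.sqrt_pos.2 (norm_pos_iff.2 h0)
      exact_mod_cast this.ne'
    field_simp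
    linear_combination h1

theorem attachFun_attachInv {q : E3} (h : offset (nu q) (q 2) ≠ 0) :
    attachFun (attachInv q) = q := by
  have hn := norm_attachInv h
  refine ext_horiz ?_ rfl
  rw [attachFun, horiz_mkPt, hn, attachInv_two, attachInv, horiz_mkPt]
  have h1 := dir_mul_conj h
  rw [nu_eq, Real.sqrt_sq (norm_nonneg _)]
  rw [nu_eq] at h1
  rcases eq_or_ne (horiz q) 0 with h0 | h0
  · simp [h0]
  · have : (‖horiz q‖ : ℂ) ≠ 0 := by exact_mod_cast norm_ne_zero_iff.2 h0
    field_simp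
    linear_combination h1

theorem contDiffAt_offset {E : Type*} [NormedAddCommGroup E] [NormedSpace ℝ E] {f g : E → ℝ} {x : E}
    (hf : ContDiffAt ℝ ∞ f x) (hg : ContDiffAt ℝ ∞ g x) :
    ContDiffAt ℝ ∞ (fun y => offset (f y) (g y)) x :=
  Complex.equivRealProdCLM.symm.contDiff.contDiffAt.comp x
    ((hf.sub contDiffAt_const).prodMk (hg.sub contDiffAt_const))

theorem contDiffAt_attachFun {y : E3} (h0 : horiz y ≠ 0) (h : offset ‖horiz y‖ (y 2) ≠ 0) :
    ContDiffAt ℝ ∞ attachFun y := by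
  have hn : ContDiffAt ℝ ∞ (fun y => ‖horiz y‖) y :=
    contDiff_horiz.contDiffAt.norm ℝ h0
  have hs : ContDiffAt ℝ ∞ (fun y => (√‖horiz y‖ : ℂ)) y :=
    Complex.ofRealCLM.contDiff.contDiffAt.comp y (hn.sqrt (norm_ne_zero_iff.2 h0))
  have hs0 : (√‖horiz y‖ : ℂ) ≠ 0 := by
    have := Real.sqrt_pos.2 (norm_pos_iff.2 h0)
    exact_mod_cast this.ne'
  exact ContDiffAt.mkPt ((contDiff_horiz.contDiffAt.mul (hs.inv hs0)).mul
    (ContDiffAt.comp (g := dir) (f := fun y : E3 => offset ‖horiz y‖ (y 2)) y (contDiffAt_dir h)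
      (contDiffAt_offset hn (by fun_prop)))) (by fun_prop)

theorem contDiffAt_attachInv {q : E3} (h0 : horiz q ≠ 0) (h : offset (nu q) (q 2) ≠ 0) :
    ContDiffAt ℝ ∞ attachInv q := by
  have hn : ContDiffAt ℝ ∞ (fun y => (‖horiz y‖ : ℂ)) q :=
    Complex.ofRealCLM.contDiff.contDiffAt.comp q (contDiff_horiz.contDiffAt.norm ℝ h0)
  have hd : ContDiffAt ℝ ∞ (fun q => dir (offset (nu q) (q 2))) q :=
    ContDiffAt.comp (g := dir) (f := fun q : E3 => offset (nu q) (q 2)) q (contDiffAt_dir h)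
      (contDiffAt_offset (by fun_prop) (by fun_prop))
  exact ContDiffAt.mkPt ((contDiff_horiz.contDiffAt.mul hn).mul
    (Complex.conjCLE.contDiff.contDiffAt.comp q hd)) (by fun_prop)

theorem horiz_ne_zero_of_nu {q : E3} (h : 0 < nu q) : horiz q ≠ 0 := by
  intro h0
  rw [nu_eq, h0] at h
  simp at h

/-- The domain of the attaching map. -/
def attachSource : Set E3 := thickAnnulus ∩ {y | IsOuter (‖horiz y‖ - 3 / 2) (y 2)}

/-- The image of the attaching map. -/
def attachTarget : Set E3 := body ∩ {q | IsOuter (rad q) (q 2)}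

theorem attachSource_norm {y : E3} (h : y ∈ attachSource) :
    (1 ≤ ‖horiz y‖ ∧ ‖horiz y‖ ≤ 2) ∧ 0 ≤ y 2 ∧ y 2 ≤ 1 := by
  have := h.1
  rw [thickAnnulus_eq] at this
  exact this

theorem attachSource_horiz {y : E3} (h : y ∈ attachSource) : horiz y ≠ 0 := by
  intro h0
  have := (attachSource_norm h).1.1
  rw [h0, norm_zero] at this
  linarith

/-- The attaching map as a partial equivalence. -/
def attach : PartialEquiv E3 E3 where
  toFun := attachFun
  invFun := attachInv
  source := attachSource
  target := attachTarget
  map_source' y hy := by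
    have hnu := nu_attachFun (offset_ne_zero hy.2)
    obtain ⟨h1, h2⟩ := attachSource_norm hy
    refine ⟨⟨by rw [hnu]; exact h1, h2⟩, ?_⟩
    change IsOuter (nu (attachFun y) - 3 / 2) (y 2)
    rw [hnu]; exact hy.2
  map_target' q hq := by
    have hn := norm_attachInv (offset_ne_zero hq.2)
    refine ⟨?_, ?_⟩
    · rw [thickAnnulus_eq]
      exact ⟨by rw [hn]; exact hq.1.1, hq.1.2⟩
    · change IsOuter (‖horiz (attachInv q)‖ - 3 / 2) (q 2)
      rw [hn]; exact hq.2
  left_inv' y hy := attachInv_attachFun (offset_ne_zero hy.2)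
  right_inv' q hq := attachFun_attachInv (offset_ne_zero hq.2)

/-- Vertical segments are carried to trajectories. -/
theorem hasDerivAt_attachFun {c : ℂ} {z : ℝ} (h : IsOuter (‖c‖ - 3 / 2) z) :
    HasDerivAt (fun z => attachFun (mkPt c z)) (vfield (attachFun (mkPt c z))) z := by
  have h0 := offset_ne_zero h
  have hnu : nu (attachFun (mkPt c z)) = ‖c‖ := nu_attachFun h0
  have ho : HasDerivWithinAt (fun z => offset ‖c‖ z) Complex.I Set.univ z := by
    have h1 : HasDerivWithinAt (fun z : ℝ => (‖c‖ - 3 / 2, z - 1 / 2)) ((0 : ℝ), (1 : ℝ))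
        Set.univ z :=
      (hasDerivWithinAt_const z _ _).prodMk ((hasDerivWithinAt_id z _).sub_const _)
    exact (Complex.equivRealProdCLM.symm.hasFDerivAt.comp_hasDerivWithinAt z h1).congr_deriv
      (by simp [Complex.ext_iff])
  have h1 := HasDerivAt.mkPt ((HasDerivWithinAt.dir ho h0).hasDerivAt Filter.univ_mem |>.const_mul
    (c / √‖c‖)) (hasDerivAt_id z)
  refine HasDerivAt.congr_deriv h1 ?_
  have ho' : IsOuter (rad (attachFun (mkPt c z))) z := by rw [rad, hnu]; exact h
  have he : expand (attachFun (mkPt c z)) = 0 := expand_eq_zero ho'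
  have hs : speed (attachFun (mkPt c z)) =
      ((starRingEnd ℂ) (offset ‖c‖ z) * Complex.I).im / ‖offset ‖c‖ z‖ ^ 2 := by
    rw [speed, attachFun_two, mkPt_two, ho'.spin, ho'.twist, norm_offset_sq, rad, hnu]
    simp [offset]
  refine ext_horiz ?_ ?_
  · rw [horiz_vfield, he, hs, horiz_mkPt, attachFun, horiz_mkPt, horiz_mkPt, mkPt_two]
    push_cast
    ring
  · rw [vfield_two, attachFun_two, mkPt_two, mkPt_two, ho'.fieldZ]

theorem isOpen_isOuter {f g : E3 → ℝ} (hf : Continuous f) (hg : Continuous g) :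
    IsOpen {y | IsOuter (f y) (g y)} := by
  have a : Continuous fun y => distA (f y) (g y) := by unfold distA; fun_prop
  have b : Continuous fun y => distB (f y) (g y) := by unfold distB; fun_prop
  exact (isOpen_lt continuous_const a).inter (isOpen_lt continuous_const b)

theorem continuous_height : Continuous fun q : E3 => q 2 := (contDiff_coord 2).continuous

theorem isOpen_outer_source : IsOpen {y : E3 | IsOuter (‖horiz y‖ - 3 / 2) (y 2)} :=
  isOpen_isOuter (continuous_horiz.norm.sub continuous_const) continuous_height

theorem frontier_thickAnnulus_subset :
    frontier thickAnnulus ⊆ {y : E3 | IsOuter (‖horiz y‖ - 3 / 2) (y 2)} := by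
  intro y hy
  by_contra h
  have h1 : Continuous fun q : E3 => ‖horiz q‖ := continuous_horiz.norm
  have hopen : IsOpen {q : E3 | (1 < ‖horiz q‖ ∧ ‖horiz q‖ < 2) ∧ 0 < q 2 ∧ q 2 < 1} :=
    ((isOpen_lt continuous_const h1).inter (isOpen_lt h1 continuous_const)).inter
    ((isOpen_lt continuous_const continuous_height).inter
      (isOpen_lt continuous_height continuous_const))
  have hsub : {q : E3 | (1 < ‖horiz q‖ ∧ ‖horiz q‖ < 2) ∧ 0 < q 2 ∧ q 2 < 1} ⊆ thickAnnulus := by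
    rw [thickAnnulus_eq]
    exact fun q hq => ⟨⟨hq.1.1.le, hq.1.2.le⟩, hq.2.1.le, hq.2.2.le⟩
  refine hy.2 (interior_maximal hsub hopen ?_)
  have hx : |‖horiz y‖ - 3 / 2| < 1 / 2 := by
    by_contra hx
    exact h (isOuter_of_abs (not_lt.1 hx))
  have hz : 1 / 4 < y 2 := by
    by_contra hz
    exact h (isOuter_of_le (not_lt.1 hz))
  have hz' : y 2 < 1 := by
    by_contra hz
    exact h (isOuter_of_ge (not_lt.1 hz))
  rw [abs_lt] at hx
  exact ⟨⟨by linarith, by linarith⟩, by linarith, hz'⟩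

theorem uniqueDiffOn_attachSource : UniqueDiffOn ℝ attachSource :=
  uniqueDiffOn_thickAnnulus.inter isOpen_outer_source

/-- Identification of the annulus with the entry region. -/
def entryMap (x : E2) : E3 := attachFun (lift x 0)

/-- Identification of the annulus with the exit region. -/
def exitMap (x : E2) : E3 := attachFun (lift x 1)

theorem isAttachingMap_attach : IsAttachingMap vfield body entryMap exitMap attach where
  source_eq := ⟨_, isOpen_outer_source, frontier_thickAnnulus_subset, rfl⟩
  target_eq := by
    refine ⟨_, isOpen_isOuter contDiff_rad.continuous continuous_height, ?_, rfl⟩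
    intro q hq
    rcases (frontier_body_cases hq).2 with h | h
    · exact isOuter_of_lateral h
    · exact isOuter_of_horizontal h
  smooth := fun _ hy =>
    (contDiffAt_attachFun (attachSource_horiz hy) (offset_ne_zero hy.2)).contDiffWithinAt
  smooth_symm := fun _ hq => (contDiffAt_attachInv (horiz_ne_zero_of_nu (body_nu_pos hq.1))
    (offset_ne_zero hq.2)).contDiffWithinAt
  leaf := by
    intro y hy
    refine ⟨1, one_pos, ?_⟩
    have h0 := attachSource_horiz hy
    have hd : DifferentiableAt ℝ attachFun y :=
      (contDiffAt_attachFun h0 (offset_ne_zero hy.2)).differentiableAt (by simp)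
    change fderivWithin ℝ attachFun attachSource y (EuclideanSpace.single 2 1) =
      (1 : ℝ) • vfield (attachFun y)
    rw [hd.fderivWithin (uniqueDiffOn_attachSource y hy), one_smul]
    have h1 : HasDerivAt (fun z => mkPt (horiz y) z) (EuclideanSpace.single 2 1) (y 2) := by
      refine HasDerivAt.congr_deriv
        (HasDerivAt.mkPt (hasDerivAt_const (y 2) (horiz y)) (hasDerivAt_id (y 2))) ?_
      ext i
      fin_cases i <;> simp
    have h2 : HasFDerivAt attachFun (fderiv ℝ attachFun y) (mkPt (horiz y) (y 2)) := by
      rw [mkPt_horiz]; exact hd.hasFDerivAt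
    have h3 := h2.comp_hasDerivAt (y 2) h1
    have h4 := hasDerivAt_attachFun hy.2
    rw [mkPt_horiz] at h4
    exact h3.unique h4
  bottom := fun _ _ => rfl
  top := fun _ _ => rfl

/-! ### The ends of the plug -/

theorem lift_mem_attachSource {x : E2} (hx : x ∈ annulus) {z : ℝ} (hz : z = 0 ∨ z = 1) :
    lift x z ∈ attachSource := by
  refine ⟨⟨x, hx, z, ?_, rfl⟩, ?_⟩
  · rcases hz with rfl | rfl <;> norm_num
  · rcases hz with rfl | rfl
    · exact isOuter_of_le (by rw [lift_eq, mkPt_two]; norm_num)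
    · exact isOuter_of_ge (by rw [lift_eq, mkPt_two])

theorem bijOn_face {z : ℝ} (hz : z = 0 ∨ z = 1) :
    Set.BijOn (fun x => attachFun (lift x z)) annulus {q | q ∈ body ∧ q 2 = z} := by
  refine ⟨fun x hx => ?_, fun x hx y hy h => ?_, ?_⟩
  · exact ⟨(attach.map_source (lift_mem_attachSource hx hz)).1, rfl⟩
  · have := attach.injOn (lift_mem_attachSource hx hz) (lift_mem_attachSource hy hz) h
    have h2 : toC x = toC y := congrArg horiz this
    rw [← ofC_toC x, h2, ofC_toC]
  · rintro q ⟨hq, rfl⟩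
    have hq' : q ∈ attachTarget := ⟨hq, isOuter_of_horizontal hz⟩
    have hs := attachSource_norm (attach.map_target hq')
    refine ⟨ofC (horiz (attachInv q)), ?_, ?_⟩
    · rw [annulus, Set.mem_ofPred_eq, ← norm_toC, toC_ofC]; exact hs.1
    · have : lift (ofC (horiz (attachInv q))) (q 2) = attachInv q := by
        rw [lift_eq, toC_ofC]
        exact mkPt_horiz (attachInv q)
      change attachFun (lift (ofC (horiz (attachInv q))) (q 2)) = q
      rw [this]
      exact attach.right_inv hq'

theorem contDiffAt_face {z : ℝ} (hz : z = 0 ∨ z = 1) {x : E2} (hx : x ∈ annulus) :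
    ContDiffAt ℝ ∞ (fun x => attachFun (lift x z)) x := by
  have hs := lift_mem_attachSource hx hz
  refine ContDiffAt.comp (g := attachFun) (f := fun x => lift x z) x
    (contDiffAt_attachFun (attachSource_horiz hs) (offset_ne_zero hs.2)) ?_
  exact ContDiffAt.mkPt contDiff_toC.contDiffAt contDiffAt_const

/-- Inverting the attaching map and projecting to the plane gives a differentiable left inverse;
unique differentiability of the annulus turns this into a left inverse of the derivative within it.
-/
theorem injective_face {z : ℝ} (hz : z = 0 ∨ z = 1) {x : E2} (hx : x ∈ annulus) :
    Function.Injective (fderivWithin ℝ (fun x => attachFun (lift x z)) annulus x) := by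
  have hs := lift_mem_attachSource hx hz
  have hu := uniqueDiffOn_annulus x hx
  have hd : HasFDerivWithinAt (fun x => attachFun (lift x z))
      (fderivWithin ℝ (fun x => attachFun (lift x z)) annulus x) annulus x :=
    ((contDiffAt_face hz hx).differentiableAt (by simp)).differentiableWithinAt.hasFDerivWithinAt
  have ht := attach.map_source hs
  have hi : DifferentiableAt ℝ attachInv (attachFun (lift x z)) :=
    (contDiffAt_attachInv (horiz_ne_zero_of_nu (body_nu_pos ht.1))
      (offset_ne_zero ht.2)).differentiableAt (by simp)
  have hL : DifferentiableAt ℝ (fun q => ofC (horiz (attachInv q))) (attachFun (lift x z)) :=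
    (planeC.symm.contDiff.comp contDiff_horiz).differentiable (n := ∞) (by simp) _ |>.comp _ hi
  have hcomp := hL.hasFDerivAt.comp_hasFDerivWithinAt x hd
  have hid : HasFDerivWithinAt ((fun q => ofC (horiz (attachInv q))) ∘
      fun x => attachFun (lift x z)) (ContinuousLinearMap.id ℝ E2) annulus x := by
    refine (hasFDerivWithinAt_id x annulus).congr ?_ ?_
    all_goals
      try intro y hy
      simp only [Function.comp_apply, id]
      rw [attachInv_attachFun (offset_ne_zero (lift_mem_attachSource (by assumption) hz).2),
        lift_eq, horiz_mkPt, ofC_toC]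
  have heq := hu.eq hcomp hid
  intro u v huv
  have := congrArg (fun f : E2 →L[ℝ] E2 => f u - f v) heq
  simp only [ContinuousLinearMap.comp_apply, huv, sub_self, ContinuousLinearMap.id_apply] at this
  exact (sub_eq_zero.1 this.symm)

/-! ### Lateral leaves -/

/-- Over ν = 1 and ν = 2 every height is in the outer region, so the attaching formula carries a
complete vertical segment to a leaf. -/
theorem isOnFiniteLeaf_lateral {p : E3} (hp : p ∈ body) (h : nu p = 1 ∨ nu p = 2) :
    IsOnFiniteLeaf vfield body p := by
  have ho (z : ℝ) : IsOuter (nu p - 3 / 2) z := by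
    apply isOuter_of_abs
    rcases h with h | h <;> rw [h] <;> norm_num [abs_of_nonneg, abs_of_neg]
  have hpt : p ∈ attachTarget := ⟨hp, isOuter_of_lateral h⟩
  set c := horiz (attachInv p) with hcdef
  have hcn : ‖c‖ = nu p := norm_attachInv (offset_ne_zero hpt.2)
  have hpc : attachFun (mkPt c (p 2)) = p := by
    have h1 : mkPt c (p 2) = attachInv p := mkPt_horiz (attachInv p)
    rw [h1]; exact attach.right_inv hpt
  have hmem (z : ℝ) (hz : z ∈ Set.Icc (0 : ℝ) 1) : attachFun (mkPt c z) ∈ body := by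
    refine ⟨?_, hz⟩
    rw [nu_attachFun (offset_ne_zero (by rw [horiz_mkPt, hcn]; exact ho _)), horiz_mkPt, hcn]
    exact hp.1
  obtain ⟨-, hz0, hz1⟩ := id hp
  refine ⟨-p 2, 1 - p 2, fun t => attachFun (mkPt c (p 2 + t)), by linarith,
    ⟨by linarith, by linarith⟩, ?_, by simpa using hpc, ?_, ?_⟩
  · rintro t ⟨ht1, ht2⟩
    refine ⟨hmem _ ⟨by linarith, by linarith⟩, ?_⟩
    have := hasDerivAt_attachFun (c := c) (z := p 2 + t) (by rw [hcn]; exact ho _)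
    exact (HasDerivAt.comp_const_add (p 2) t this).hasDerivWithinAt
  · rw [entryRegion_eq]
    refine ⟨hmem _ ?_, ?_⟩ <;> simp
  · rw [exitRegion_eq]
    refine ⟨hmem _ ?_, ?_⟩ <;> simp

theorem isFlowBordism_vfield : IsFlowBordism vfield body where
  compact := isCompact_body
  orthantDomain := isOrthantDomain_body
  smooth := contDiffOn_vfield
  ne_zero := fun _ hp => vfield_ne_zero hp
  boundary := fun _ hp => boundary_cases hp
  finite_of_parallel := fun _ hp => isOnFiniteLeaf_lateral hp.lateral.1 hp.lateral.2

/-! ### The square and the disk -/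

/-- The maximum norm of the plane. -/
def squareNorm : Seminorm ℝ E2 :=
  (normSeminorm ℝ ℝ).comp (EuclideanSpace.proj (𝕜 := ℝ) (0 : Fin 2)).toLinearMap ⊔
    (normSeminorm ℝ ℝ).comp (EuclideanSpace.proj (𝕜 := ℝ) (1 : Fin 2)).toLinearMap

theorem squareNorm_apply (x : E2) : squareNorm x = max |x 0| |x 1| := rfl

theorem continuous_squareNorm : Continuous squareNorm := by
  have h (i : Fin 2) : Continuous fun x : E2 => |x i| :=
    ((EuclideanSpace.proj (𝕜 := ℝ) i).continuous).abs
  exact (h 0).max (h 1)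

/-- A homeomorphism of the plane which carries the unit disk to the square. -/
def diskToSquare : E2 ≃ₜ E2 :=
  gaugeRescaleHomeomorph (Metric.ball 0 1) (squareNorm.ball 0 1) (convex_ball _ _)
    (Metric.ball_mem_nhds _ one_pos) (NormedSpace.isVonNBounded_ball ℝ E2 1)
    (squareNorm.convex_ball _ _)
    (by
      rw [Seminorm.ball_zero_eq]
      exact (isOpen_lt continuous_squareNorm continuous_const).mem_nhds (by simp))
    (by
      refine (NormedSpace.isVonNBounded_closedBall ℝ E2 2).subset fun x hx => ?_
      rw [Seminorm.mem_ball_zero, squareNorm_apply, max_lt_iff, abs_lt, abs_lt] at hx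
      rw [mem_closedBall_zero_iff, EuclideanSpace.norm_eq, Real.sqrt_le_left (by norm_num)]
      simp only [Fin.sum_univ_two, Real.norm_eq_abs, sq_abs]
      nlinarith [hx.1.1, hx.1.2, hx.2.1, hx.2.2])

theorem diskToSquare_apply (x : E2) : diskToSquare x = (‖x‖ / squareNorm x) • x := by
  change gaugeRescale _ _ x = _
  rw [gaugeRescale_def, Seminorm.gauge_ball, gauge_unit_ball]

theorem squareNorm_eq_zero {x : E2} (h : squareNorm x = 0) : x = 0 := by
  rw [squareNorm_apply] at h
  have h0 : |x 0| ≤ 0 := h ▸ le_max_left _ _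
  have h1 : |x 1| ≤ 0 := h ▸ le_max_right _ _
  ext i
  fin_cases i
  · exact abs_nonpos_iff.1 h0
  · exact abs_nonpos_iff.1 h1

theorem squareNorm_diskToSquare (x : E2) : squareNorm (diskToSquare x) = ‖x‖ := by
  rw [diskToSquare_apply, map_smul_eq_mul]
  rcases eq_or_ne (squareNorm x) 0 with h | h
  · rw [h, squareNorm_eq_zero h]; simp
  · rw [Real.norm_of_nonneg (div_nonneg (norm_nonneg _) (apply_nonneg _ _))]
    field_simp

theorem square_bounds {u : E2} (h : squareNorm u ≤ 1) :
    (1 ≤ 3 / 2 + u 0 / 2 ∧ 3 / 2 + u 0 / 2 ≤ 2) ∧ 0 ≤ 1 / 2 + u 1 / 2 ∧ 1 / 2 + u 1 / 2 ≤ 1 := by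
  rw [squareNorm_apply, max_le_iff, abs_le, abs_le] at h
  obtain ⟨⟨h1, h2⟩, h3, h4⟩ := h
  refine ⟨⟨?_, ?_⟩, ?_, ?_⟩ <;> linarith

/-- The meridian square. -/
def meridianSquare (u : E2) : E3 := mkPt (√(3 / 2 + u 0 / 2) : ℝ) (1 / 2 + u 1 / 2)

theorem nu_meridianSquare {u : E2} (h : squareNorm u ≤ 1) :
    nu (meridianSquare u) = 3 / 2 + u 0 / 2 := by
  have := (square_bounds h).1.1
  rw [meridianSquare, nu_mkPt, Complex.norm_real, Real.norm_eq_abs, sq_abs,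
    Real.sq_sqrt (by linarith)]

theorem continuous_meridianSquare : Continuous meridianSquare := by
  have h (i : Fin 2) : Continuous fun x : E2 => x i := (EuclideanSpace.proj (𝕜 := ℝ) i).continuous
  have h0 := h 0
  have h1 := h 1
  exact Continuous.mkPt (Complex.continuous_ofReal.comp (by fun_prop)) (by fun_prop)

/-- The curve has polar angle −t, while its offset from the centre of the square points in the
direction t. The rotation in the attaching map cancels the angle, so the image stays in the slice of
angle 0. -/
theorem attachFun_slopeCurve (t : ℝ) : attachFun (slopeCurve (-1) t) =
    meridianSquare (diskToSquare !₂[Real.cos t, Real.sin t]) := by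
  set N := max |Real.cos t| |Real.sin t| with hN
  have hNpos : 0 < N := by
    rcases eq_or_ne (Real.cos t) 0 with h | h
    · have := Real.sin_sq_add_cos_sq t
      have hs : Real.sin t ≠ 0 := by
        intro hs; rw [h, hs] at this; norm_num at this
      exact lt_max_of_lt_right (abs_pos.2 hs)
    · exact lt_max_of_lt_left (abs_pos.2 h)
  have hnorm : ‖(!₂[Real.cos t, Real.sin t] : E2)‖ = 1 := by
    rw [EuclideanSpace.norm_eq]
    simp [Fin.sum_univ_two]
  have hsq : squareNorm (!₂[Real.cos t, Real.sin t] : E2) = N := rfl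
  have hS : diskToSquare !₂[Real.cos t, Real.sin t] = (1 / N) • !₂[Real.cos t, Real.sin t] := by
    rw [diskToSquare_apply, hnorm, hsq]
  have hS0 : (diskToSquare !₂[Real.cos t, Real.sin t]) 0 = Real.cos t / N := by
    rw [hS]; simp; ring
  have hS1 : (diskToSquare !₂[Real.cos t, Real.sin t]) 1 = Real.sin t / N := by
    rw [hS]; simp; ring
  have hb := square_bounds (u := diskToSquare !₂[Real.cos t, Real.sin t])
    (by rw [squareNorm_diskToSquare, hnorm])
  rw [meridianSquare, hS0, hS1]
  rw [hS0] at hb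
  set r := 3 / 2 + Real.cos t / N / 2 with hr
  have hr1 : 1 ≤ r := hb.1.1
  have hcurve : slopeCurve (-1) t =
      mkPt (r * Complex.exp ((-t : ℝ) * Complex.I)) (1 / 2 + Real.sin t / N / 2) := by
    ext i
    fin_cases i
    · change (3 / 2 + Real.cos t / (2 * N)) * Real.cos ((-1 : ℤ) * t) =
        (r * Complex.exp ((-t : ℝ) * Complex.I)).re
      rw [Complex.re_ofReal_mul, Complex.exp_ofReal_mul_I_re, hr]
      push_cast; field_simp
    · change (3 / 2 + Real.cos t / (2 * N)) * Real.sin ((-1 : ℤ) * t) =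
        (r * Complex.exp ((-t : ℝ) * Complex.I)).im
      rw [Complex.im_ofReal_mul, Complex.exp_ofReal_mul_I_im, hr]
      push_cast; field_simp
    · change 1 / 2 + Real.sin t / (2 * N) = 1 / 2 + Real.sin t / N / 2
      field_simp
  have hn : ‖horiz (slopeCurve (-1) t)‖ = r := by
    rw [hcurve, horiz_mkPt, norm_mul, Complex.norm_exp_ofReal_mul_I, mul_one, Complex.norm_real,
      Real.norm_of_nonneg (by linarith)]
  have hoff : offset r (1 / 2 + Real.sin t / N / 2) =
      ((1 / (2 * N) : ℝ) : ℂ) * Complex.exp (t * Complex.I) := by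
    apply Complex.ext
    · rw [Complex.re_ofReal_mul, Complex.exp_ofReal_mul_I_re]; simp [offset, hr]; field_simp
    · rw [Complex.im_ofReal_mul, Complex.exp_ofReal_mul_I_im]; simp [offset]; field_simp
  rw [attachFun, hn, hcurve, mkPt_two, horiz_mkPt, hoff, dir_smul (by positivity),
    dir_of_norm_eq_one (Complex.norm_exp_ofReal_mul_I t)]
  congr 1
  have h1 : Complex.exp ((-t : ℝ) * Complex.I) * Complex.exp (t * Complex.I) = 1 := by
    rw [← Complex.exp_add]; simp
  have hsr : (√r : ℂ) ≠ 0 := by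
    have := Real.sqrt_pos.2 (by linarith : 0 < r)
    exact_mod_cast this.ne'
  have hss : (√r : ℂ) * √r = r := by
    rw [← Complex.ofReal_mul, Real.mul_self_sqrt (by linarith)]
  generalize Complex.exp ((-t : ℝ) * Complex.I) = a at h1 ⊢
  generalize Complex.exp (t * Complex.I) = b at h1 ⊢
  field_simp
  linear_combination (r : ℂ) * h1 - hss

theorem boundsDisk_meridian : BoundsDisk body fun t => attach (slopeCurve (-1) t) := by
  refine ⟨fun u => meridianSquare (diskToSquare u), ?_, ?_, ?_, ?_⟩
  · exact (continuous_meridianSquare.comp diskToSquare.continuous).continuousOn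
  · intro u hu v hv h
    have hu' : squareNorm (diskToSquare u) ≤ 1 := by
      rw [squareNorm_diskToSquare]; simpa using hu
    have hv' : squareNorm (diskToSquare v) ≤ 1 := by
      rw [squareNorm_diskToSquare]; simpa using hv
    have h0 : nu (meridianSquare (diskToSquare u)) = nu (meridianSquare (diskToSquare v)) :=
      congrArg nu h
    rw [nu_meridianSquare hu', nu_meridianSquare hv'] at h0
    have h1 : 1 / 2 + (diskToSquare u) 1 / 2 = 1 / 2 + (diskToSquare v) 1 / 2 :=
      congrArg (fun q : E3 => q 2) h
    apply diskToSquare.injective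
    ext i
    fin_cases i
    · change (diskToSquare u) 0 = (diskToSquare v) 0; linarith
    · change (diskToSquare u) 1 = (diskToSquare v) 1; linarith
  · intro u hu
    have hu' : squareNorm (diskToSquare u) < 1 := by
      rw [squareNorm_diskToSquare]; simpa using hu
    apply core_subset_interior
    have hn := nu_meridianSquare hu'.le
    rw [squareNorm_apply, max_lt_iff, abs_lt, abs_lt] at hu'
    obtain ⟨⟨h1, h2⟩, h3, h4⟩ := hu'
    refine ⟨by rw [hn]; exact ⟨by linarith, by linarith⟩, ?_⟩
    change 0 < 1 / 2 + (diskToSquare u) 1 / 2 ∧ 1 / 2 + (diskToSquare u) 1 / 2 < 1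
    exact ⟨by linarith, by linarith⟩
  · exact fun t => (attachFun_slopeCurve t).symm

/-- The point of the square below a point of the body. -/
def squarePoint (q : E3) : E2 := !₂[2 * nu q - 3, 2 * q 2 - 1]

theorem continuous_squarePoint : Continuous squarePoint := by
  have h := continuous_height
  have : Continuous fun q : E3 => ![2 * nu q - 3, 2 * q 2 - 1] := by fun_prop
  exact (PiLp.continuous_toLp 2 _).comp this

theorem squareNorm_squarePoint {q : E3} (hq : q ∈ body) : squareNorm (squarePoint q) ≤ 1 := by
  rw [squareNorm_apply, max_le_iff, abs_le, abs_le]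
  change (-1 ≤ 2 * nu q - 3 ∧ 2 * nu q - 3 ≤ 1) ∧ -1 ≤ 2 * q 2 - 1 ∧ 2 * q 2 - 1 ≤ 1
  obtain ⟨⟨h1, h2⟩, h3, h4⟩ := hq
  refine ⟨⟨?_, ?_⟩, ?_, ?_⟩ <;> linarith

/-- The point of the body over a direction and a point of the square. -/
def torusPoint (c : ℂ) (u : E2) : E3 := mkPt ((√(3 / 2 + u 0 / 2) : ℝ) * c) (1 / 2 + u 1 / 2)

theorem nu_torusPoint {c : ℂ} (hc : ‖c‖ = 1) {u : E2} (h : squareNorm u ≤ 1) :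
    nu (torusPoint c u) = 3 / 2 + u 0 / 2 := by
  have := (square_bounds h).1.1
  rw [torusPoint, nu_mkPt, norm_mul, hc, mul_one, Complex.norm_real, Real.norm_eq_abs, sq_abs,
    Real.sq_sqrt (by linarith)]

/-- The direction and the pair (ν, z) present the body as circle times square; rescaling by gauges
turns the square into the round disk. -/
theorem isSolidTorus_body : IsSolidTorus body := by
  have hmem (p : Circle × Metric.closedBall (0 : E2) 1) :
      squareNorm (diskToSquare (p.2 : E2)) ≤ 1 := by
    rw [squareNorm_diskToSquare]; exact mem_closedBall_zero_iff.1 p.2.2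
  refine ⟨{ toFun := fun q => (⟨dir (horiz q), ?_⟩, ⟨diskToSquare.symm (squarePoint q), ?_⟩)
            invFun := fun p => ⟨torusPoint p.1 (diskToSquare p.2), ?_⟩
            left_inv := ?_
            right_inv := ?_
            continuous_toFun := ?_
            continuous_invFun := ?_ }⟩
  · exact mem_sphere_zero_iff_norm.2 (norm_dir (horiz_ne_zero_of_nu (body_nu_pos q.2)))
  · rw [mem_closedBall_zero_iff, ← squareNorm_diskToSquare, Homeomorph.apply_symm_apply]
    exact squareNorm_squarePoint q.2
  · have hb := square_bounds (hmem p)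
    exact ⟨by rw [nu_torusPoint p.1.norm_coe (hmem p)]; exact hb.1, hb.2⟩
  · rintro ⟨q, hq⟩
    apply Subtype.ext
    change torusPoint (dir (horiz q)) (diskToSquare (diskToSquare.symm (squarePoint q))) = q
    rw [Homeomorph.apply_symm_apply]
    refine ext_horiz ?_ ?_
    · change ((√(3 / 2 + (2 * nu q - 3) / 2) : ℝ) : ℂ) * dir (horiz q) = horiz q
      rw [show 3 / 2 + (2 * nu q - 3) / 2 = nu q by ring, nu_eq, Real.sqrt_sq (norm_nonneg _),
        norm_mul_dir]
    · change 1 / 2 + (2 * q 2 - 1) / 2 = q 2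
      ring
  · intro p
    have h1 : dir (horiz (torusPoint p.1 (diskToSquare p.2))) = p.1 := by
      have := (square_bounds (hmem p)).1.1
      rw [torusPoint, horiz_mkPt, dir_smul (Real.sqrt_pos.2 (by linarith)),
        dir_of_norm_eq_one p.1.norm_coe]
    have h2 : squarePoint (torusPoint p.1 (diskToSquare p.2)) = diskToSquare p.2 := by
      ext i
      fin_cases i
      · change 2 * nu (torusPoint p.1 (diskToSquare p.2)) - 3 = (diskToSquare (p.2 : E2)) 0
        rw [nu_torusPoint p.1.norm_coe (hmem p)]; ring
      · change 2 * (1 / 2 + (diskToSquare (p.2 : E2)) 1 / 2) - 1 = (diskToSquare (p.2 : E2)) 1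
        ring
    refine Prod.ext (Subtype.ext h1) (Subtype.ext ?_)
    change diskToSquare.symm (squarePoint (torusPoint p.1 (diskToSquare p.2))) = p.2
    rw [h2, Homeomorph.symm_apply_apply]
  · refine Continuous.prodMk (Continuous.subtype_mk ?_ _) (Continuous.subtype_mk ?_ _)
    · rw [continuous_iff_continuousAt]
      intro q
      exact ((contDiffAt_dir (horiz_ne_zero_of_nu (body_nu_pos q.2))).continuousAt.comp
        continuous_horiz.continuousAt).comp continuous_subtype_val.continuousAt
    · exact diskToSquare.symm.continuous.comp
        (continuous_squarePoint.comp continuous_subtype_val)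
  · refine Continuous.subtype_mk ?_ _
    have h (i : Fin 2) : Continuous fun x : E2 => x i := (EuclideanSpace.proj (𝕜 := ℝ) i).continuous
    have hs : Continuous fun p : Circle × Metric.closedBall (0 : E2) 1 =>
        diskToSquare (p.2 : E2) :=
      diskToSquare.continuous.comp (continuous_subtype_val.comp continuous_snd)
    have h0 := (h 0).comp hs
    have h1 := (h 1).comp hs
    refine Continuous.mkPt (Continuous.mul (Complex.continuous_ofReal.comp ?_) ?_) ?_
    · exact Real.continuous_sqrt.comp (continuous_const.add (h0.div_const 2))
    · exact continuous_subtype_val.comp continuous_fst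
    · exact continuous_const.add (h1.div_const 2)

theorem isIntegrallyDehnTwisted_vfield :
    IsIntegrallyDehnTwisted vfield body entryMap exitMap :=
  ⟨isSolidTorus_body, attach, isAttachingMap_attach, Or.inr boundsDisk_meridian⟩

/-! ### Trajectories in cylindrical coordinates -/

section trajectory
variable {γ : ℝ → E3} {J : Set ℝ} {t : ℝ}

theorem IsTrajectoryOn.horiz (h : IsTrajectoryOn vfield body γ J) (ht : t ∈ J) :
    HasDerivWithinAt (fun t => horiz (γ t))
      ((expand (γ t) + speed (γ t) * Complex.I) * horiz (γ t)) J t :=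
  HasDerivWithinAt.horiz (h t ht).2

theorem IsTrajectoryOn.height (h : IsTrajectoryOn vfield body γ J) (ht : t ∈ J) :
    HasDerivWithinAt (fun t => γ t 2) (fieldZ (rad (γ t)) (γ t 2)) J t :=
  HasDerivWithinAt.height (h t ht).2

/-- The denominator 2ν in `expand` is chosen for this: rotation does not affect ν, and the radial
part changes it at the rate 2ν · `expand` = `fieldX`. -/
theorem IsTrajectoryOn.rad (h : IsTrajectoryOn vfield body γ J) (ht : t ∈ J) :
    HasDerivWithinAt (fun t => rad (γ t)) (fieldX (rad (γ t)) (γ t 2)) J t := by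
  have h1 := ((h.horiz ht).norm_sq).sub_const (3 / 2)
  have hn := body_nu_pos (h t ht).1
  refine (h1.congr_deriv ?_).congr_of_mem (fun s _ => ?_) ht
  · rw [Complex.inner]
    have : (expand (γ t) + speed (γ t) * Complex.I) * DehnPlug.horiz (γ t) *
        (starRingEnd ℂ) (DehnPlug.horiz (γ t)) =
        (expand (γ t) + speed (γ t) * Complex.I) * (nu (γ t) : ℂ) := by
      rw [mul_assoc, Complex.mul_conj, Complex.normSq_eq_norm_sq, nu_eq]
    rw [this, Complex.re_mul_ofReal]
    simp only [Complex.add_re, Complex.ofReal_re, Complex.re_ofReal_mul, Complex.I_re, mul_zero,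
      add_zero, expand]
    field_simp
  · rw [DehnPlug.rad, nu_eq]

end trajectory

theorem eq_of_derivWithin_zero {E : Type*} [NormedAddCommGroup E] [NormedSpace ℝ E] {f : ℝ → E}
    {a b : ℝ} (h : ∀ t ∈ Set.Icc a b, HasDerivWithinAt f 0 (Set.Icc a b) t) :
    ∀ t ∈ Set.Icc a b, f t = f a := by
  refine constant_of_has_deriv_right_zero (fun t ht => (h t ht).continuousWithinAt) fun t ht => ?_
  exact (h t ⟨ht.1, ht.2.le⟩).mono_of_mem_nhdsWithin (Icc_mem_nhdsGE_of_mem ht)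

theorem height_monotoneOn {γ : ℝ → E3} {a b : ℝ}
    (h : IsTrajectoryOn vfield body γ (Set.Icc a b)) :
    MonotoneOn (fun t => γ t 2) (Set.Icc a b) := by
  refine monotoneOn_of_deriv_nonneg (convex_Icc a b)
    (fun t ht => (h.height ht).continuousWithinAt) ?_ ?_ <;> intro t ht
  · have ht' := interior_subset ht
    exact ((h.height ht').mono interior_subset).differentiableWithinAt
  · have ht' := interior_subset ht
    have hd := (h.height ht').hasDerivAt (mem_interior_iff_mem_nhds.1 ht)
    rw [hd.deriv]
    exact fieldZ_nonneg _ _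

/-! ### Uniqueness for the planar field -/

theorem planar_unique {f g : ℝ → ℝ × ℝ} {a b t₀ R : ℝ} (ht₀ : t₀ ∈ Set.Ioo a b)
    (hf : ContinuousOn f (Set.Icc a b)) (hg : ContinuousOn g (Set.Icc a b))
    (hf' : ∀ t ∈ Set.Ioo a b, HasDerivAt f (fieldX (f t).1 (f t).2, fieldZ (f t).1 (f t).2) t)
    (hg' : ∀ t ∈ Set.Ioo a b, HasDerivAt g (fieldX (g t).1 (g t).2, fieldZ (g t).1 (g t).2) t)
    (hfR : ∀ t ∈ Set.Ioo a b, ‖f t‖ ≤ R) (hgR : ∀ t ∈ Set.Ioo a b, ‖g t‖ ≤ R)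
    (h : f t₀ = g t₀) : Set.EqOn f g (Set.Icc a b) := by
  have hv : ContDiff ℝ ∞ fun p : ℝ × ℝ => (fieldX p.1 p.2, fieldZ p.1 p.2) := by
    exact ContDiff.prodMk (ContDiff.fieldX contDiff_fst contDiff_snd)
      (ContDiff.fieldZ contDiff_fst contDiff_snd)
  obtain ⟨K, hK⟩ := hv.contDiffOn.exists_lipschitzOnWith (by simp)
    (convex_closedBall (0 : ℝ × ℝ) R) (isCompact_closedBall _ _)
  exact ODE_solution_unique_of_mem_Icc (v := fun _ p => (fieldX p.1 p.2, fieldZ p.1 p.2))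
    (s := fun _ => Metric.closedBall 0 R) (fun _ _ => hK) ht₀ hf hf'
    (fun t ht => mem_closedBall_zero_iff.2 (hfR t ht)) hg hg'
    (fun t ht => mem_closedBall_zero_iff.2 (hgR t ht)) h

/-- A planar solution through a zero of the field is constant. -/
theorem planar_const {f : ℝ → ℝ × ℝ} {a b t₀ R : ℝ} (ht₀ : t₀ ∈ Set.Ioo a b)
    (hf : ContinuousOn f (Set.Icc a b))
    (hf' : ∀ t ∈ Set.Ioo a b, HasDerivAt f (fieldX (f t).1 (f t).2, fieldZ (f t).1 (f t).2) t)
    (hfR : ∀ t ∈ Set.Ioo a b, ‖f t‖ ≤ R) (h : f t₀ = (0, 1 / 2)) :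
    ∀ t ∈ Set.Icc a b, f t = (0, 1 / 2) := by
  refine planar_unique ht₀ hf continuousOn_const hf' (fun t _ => ?_) hfR
    (fun _ _ => h ▸ hfR t₀ ht₀) h
  refine (hasDerivAt_const t _).congr_deriv ?_
  simp only [fieldX_zero, fieldZ_zero, damp_half]
  rfl

/-! ### Closed leaves -/

/-- The circle of squared radius `3 / 2` at a given height. -/
def circleAt (z : ℝ) : Set E3 := {q | nu q = 3 / 2 ∧ q 2 = z}

theorem rad_circleAt {z : ℝ} {q : E3} (h : q ∈ circleAt z) : rad q = 0 := by
  rw [rad, h.1]; norm_num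

theorem range_rotation {z w : ℝ} (hw : w ≠ 0) {c : ℂ} (hc : ‖c‖ ^ 2 = 3 / 2) :
    Set.range (fun t : ℝ => mkPt (c * Complex.exp ((w * t : ℝ) * Complex.I)) z) = circleAt z := by
  have hc0 : c ≠ 0 := by rintro rfl; norm_num at hc
  ext q
  constructor
  · rintro ⟨t, rfl⟩
    refine ⟨?_, rfl⟩
    rw [nu_mkPt, norm_mul, Complex.norm_exp_ofReal_mul_I, mul_one, hc]
  · rintro ⟨h1, h2⟩
    rw [nu_eq] at h1
    have hn : ‖horiz q‖ = ‖c‖ := by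
      rw [← sq_eq_sq₀ (norm_nonneg _) (norm_nonneg _), h1, hc]
    have h3 : ‖horiz q / c‖ = 1 := by
      rw [norm_div, hn, div_self (norm_ne_zero_iff.2 hc0)]
    refine ⟨Complex.arg (horiz q / c) / w, ext_horiz ?_ h2.symm⟩
    rw [horiz_mkPt, mul_div_cancel₀ _ hw]
    have h4 := Complex.norm_mul_exp_arg_mul_I (horiz q / c)
    rw [h3, Complex.ofReal_one, one_mul] at h4
    rw [h4]; field_simp

theorem speed_of_rad_zero {q : E3} (h : rad q = 0) : speed q = spin 0 (q 2) := by
  rw [speed, h, twist_zero, add_zero]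

theorem expand_of_rad_zero {q : E3} (h : rad q = 0) : expand q = 0 := by
  rw [expand, h, fieldX_zero, zero_div]

theorem isClosedLeaf_circleAt {z : ℝ} (hz : z ∈ Set.Icc (0 : ℝ) 1) (h0 : damp 0 z = 0)
    (hw : spin 0 z ≠ 0) : IsClosedLeaf vfield body (circleAt z) := by
  set w := spin 0 z with hwdef
  have hc : ‖((√(3 / 2) : ℝ) : ℂ)‖ ^ 2 = 3 / 2 := by
    rw [Complex.norm_real, Real.norm_eq_abs, sq_abs, Real.sq_sqrt (by norm_num)]
  have hrange := range_rotation (z := z) hw hc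
  have hmem (t : ℝ) :
      mkPt ((√(3 / 2) : ℝ) * Complex.exp ((w * t : ℝ) * Complex.I)) z ∈ circleAt z := by
    rw [← hrange]; exact ⟨t, rfl⟩
  refine ⟨_, 2 * Real.pi / |w|, by positivity, fun t _ => ⟨?_, ?_⟩, fun t => ?_, hrange.symm⟩
  · obtain ⟨h1, h2⟩ := hmem t
    exact ⟨by rw [h1]; norm_num, by rw [h2]; exact hz⟩
  · apply HasDerivAt.hasDerivWithinAt
    have h1 : HasDerivAt (fun t : ℝ => ((w * t : ℝ) : ℂ) * Complex.I) (w * Complex.I) t := by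
      have : HasDerivAt (fun t : ℝ => w * t) w t := by simpa using (hasDerivAt_id t).const_mul w
      exact (Complex.ofRealCLM.hasFDerivAt.comp_hasDerivAt t this).mul_const Complex.I
    refine HasDerivAt.congr_deriv
      (HasDerivAt.mkPt (h1.cexp.const_mul _) (hasDerivAt_const t z)) ?_
    have hr := rad_circleAt (hmem t)
    refine ext_horiz ?_ ?_
    · rw [horiz_vfield, expand_of_rad_zero hr, speed_of_rad_zero hr, mkPt_two, ← hwdef]
      simp only [horiz_mkPt, Complex.ofReal_zero, zero_add]
      ring
    · rw [vfield_two, hr, mkPt_two, mkPt_two, fieldZ_zero, h0]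
  · have hper : Complex.exp ((w * (t + 2 * Real.pi / |w|) : ℝ) * Complex.I) =
        Complex.exp ((w * t : ℝ) * Complex.I) := by
      have hp := Complex.exp_periodic
      rcases abs_choice w with h | h
      · rw [h, show ((w * (t + 2 * Real.pi / w) : ℝ) : ℂ) * Complex.I =
          (w * t : ℝ) * Complex.I + 2 * Real.pi * Complex.I by
            rw [mul_add, mul_div_cancel₀ _ hw]; push_cast; ring]
        exact hp _
      · rw [h, show ((w * (t + 2 * Real.pi / -w) : ℝ) : ℂ) * Complex.I =
          (w * t : ℝ) * Complex.I - 2 * Real.pi * Complex.I by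
            rw [mul_add, div_neg, mul_neg, mul_div_cancel₀ _ hw]; push_cast; ring]
        exact hp.sub_eq _
    simp only [hper]

theorem spin_half : spin 0 (1 / 2) ≠ 0 := by rw [spin, damp_half]; norm_num

theorem spin_three_quarters : spin 0 (3 / 4) ≠ 0 := by rw [spin, damp_three_quarters]; norm_num

/-- Height is monotone and periodic along the leaf, hence constant. So `fieldZ` vanishes along it,
which places it over one of the two rest points, where the motion is a rotation of constant nonzero
speed. -/
theorem IsClosedLeaf.eq_circleAt {L : Set E3} (h : IsClosedLeaf vfield body L) :
    L = circleAt (1 / 2) ∨ L = circleAt (3 / 4) := by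
  obtain ⟨γ, T, hT, htraj, hper, rfl⟩ := h
  have hmono : Monotone fun t => γ t 2 := fun s t hst => by
    have : IsTrajectoryOn vfield body γ (Set.Icc s t) := fun r _ =>
      ⟨(htraj r trivial).1, (htraj r trivial).2.mono (Set.subset_univ _)⟩
    exact height_monotoneOn this ⟨le_rfl, hst⟩ ⟨hst, le_rfl⟩ hst
  have hle (s t : ℝ) : γ t 2 ≤ γ s 2 := by
    obtain ⟨n, hn⟩ := exists_nat_ge ((t - s) / T)
    have h1 : t ≤ s + n * T := by
      rw [div_le_iff₀ hT] at hn; linarith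
    have h2 : γ (s + n * T) = γ s := by simpa using hper.nat_mul n s
    have h3 : γ t 2 ≤ γ (s + n * T) 2 := hmono h1
    rwa [h2] at h3
  have hconst (t : ℝ) : γ t 2 = γ 0 2 := le_antisymm (hle _ _) (hle _ _)
  have hzero (t : ℝ) : fieldZ (rad (γ t)) (γ t 2) = 0 := by
    have h1 := (htraj.height (Set.mem_univ t)).hasDerivAt Filter.univ_mem
    have h2 : HasDerivAt (fun t => γ t 2) 0 t := by
      have : (fun t => γ t 2) = fun _ => γ 0 2 := funext hconst
      rw [this]; exact hasDerivAt_const t _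
    exact h1.unique h2
  have hrad (t : ℝ) : rad (γ t) = 0 := (fieldZ_eq_zero (hzero t)).1
  set z := γ 0 2 with hz
  have hw : spin 0 z ≠ 0 := by
    rcases (fieldZ_eq_zero (hzero 0)).2 with h | h
    · rw [hz, h]; exact spin_half
    · rw [hz, h]; exact spin_three_quarters
  set w := spin 0 z with hwdef
  have hd (t : ℝ) : HasDerivAt (fun t => horiz (γ t)) (w * Complex.I * horiz (γ t)) t := by
    have h1 := (htraj.horiz (Set.mem_univ t)).hasDerivAt Filter.univ_mem
    rw [expand_of_rad_zero (hrad t), speed_of_rad_zero (hrad t), hconst t, Complex.ofReal_zero,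
      zero_add] at h1
    exact h1
  have hexp (t : ℝ) : HasDerivAt (fun t : ℝ => Complex.exp ((-(w * t) : ℝ) * Complex.I))
      (Complex.exp ((-(w * t) : ℝ) * Complex.I) * (-w * Complex.I)) t := by
    have h1 : HasDerivAt (fun t : ℝ => -(w * t)) (-w) t := by
      exact ((hasDerivAt_id t).const_mul w).neg.congr_deriv (by simp)
    have h2 := (Complex.ofRealCLM.hasFDerivAt.comp_hasDerivAt t h1).mul_const Complex.I
    exact h2.cexp.congr_deriv (by simp)
  -- Multiplication by the inverse rotation leaves a function with derivative zero.
  have hprod (t : ℝ) : horiz (γ t) * Complex.exp ((-(w * t) : ℝ) * Complex.I) = horiz (γ 0) := by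
    have h1 : ∀ t, HasDerivAt (fun t => horiz (γ t) * Complex.exp ((-(w * t) : ℝ) * Complex.I)) 0 t :=
      fun t => ((hd t).mul (hexp t)).congr_deriv (by ring)
    have := is_const_of_deriv_eq_zero (fun t => (h1 t).differentiableAt) (fun t => (h1 t).deriv) t 0
    simpa using this
  have hγ : γ = fun t : ℝ => mkPt (horiz (γ 0) * Complex.exp ((w * t : ℝ) * Complex.I)) z := by
    funext t
    refine ext_horiz ?_ (hconst t)
    rw [horiz_mkPt, ← hprod t, mul_assoc, ← Complex.exp_add]
    simp
  have hc : ‖horiz (γ 0)‖ ^ 2 = 3 / 2 := by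
    have := hrad 0
    rw [rad, nu_eq] at this
    linarith
  have hr : Set.range γ = circleAt z := by
    rw [hγ]; exact range_rotation hw hc
  rw [hr]
  rcases (fieldZ_eq_zero (hzero 0)).2 with h | h
  · left; rw [hz, h]
  · right; rw [hz, h]

theorem circleAt_ne : circleAt (1 / 2) ≠ circleAt (3 / 4) := by
  intro h
  have h1 : mkPt (√(3 / 2) : ℝ) (1 / 2) ∈ circleAt (1 / 2) := by
    refine ⟨?_, rfl⟩
    rw [nu_mkPt, Complex.norm_real, Real.norm_eq_abs, sq_abs, Real.sq_sqrt (by norm_num)]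
  rw [h] at h1
  have := h1.2
  norm_num at this

theorem ncard_closedLeaves : {L | IsClosedLeaf vfield body L}.ncard = 2 := by
  have : {L | IsClosedLeaf vfield body L} = {circleAt (1 / 2), circleAt (3 / 4)} := by
    ext L
    refine ⟨fun h => IsClosedLeaf.eq_circleAt h, ?_⟩
    rintro (rfl | rfl)
    · exact isClosedLeaf_circleAt (by norm_num) damp_half spin_half
    · exact isClosedLeaf_circleAt (by norm_num) damp_three_quarters spin_three_quarters
  rw [this, Set.ncard_pair circleAt_ne]

/-! ### An infinite leaf -/

open scoped Manifold in
/-- A bounded smooth vector field on the line has a global trajectory. -/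
theorem exists_global_solution {F : ℝ → ℝ} (hF : ContDiff ℝ 1 F) (hb : ∀ x, ‖F x‖ ≤ 1) (x₀ : ℝ) :
    ∃ f : ℝ → ℝ, f 0 = x₀ ∧ ∀ t, HasDerivAt f (F (f t)) t := by
  let v : (x : ℝ) → TangentSpace 𝓘(ℝ, ℝ) x := F
  have hv : ContMDiff 𝓘(ℝ, ℝ) 𝓘(ℝ, ℝ).tangent 1 fun x => (⟨x, v x⟩ : TangentBundle 𝓘(ℝ, ℝ) ℝ) :=
    contMDiff_vectorSpace_iff_contDiff.2 hF
  have hloc : ∀ a, ∃ γ, γ 0 = x₀ ∧ IsMIntegralCurveOn γ v (Set.Ioo (-a) a) := by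
    intro a
    -- At speed at most 1 a solution stays within distance A of its start up to time A, so
    -- Picard–Lindelöf on the ball of radius A covers all of [−A, A], which contains the required
    -- interval.
    set A : NNReal := ⟨|a| + 1, by positivity⟩ with hA
    obtain ⟨K, hK⟩ := hF.contDiffOn.exists_lipschitzOnWith (by simp)
      (convex_closedBall x₀ (A : ℝ)) (isCompact_closedBall _ _)
    have hA0 : (0 : ℝ) < A := by change 0 < |a| + 1; positivity
    have hp : IsPicardLindelof (fun _ => F) (tmin := -A) (tmax := A)
        ⟨0, by simp, hA0.le⟩ x₀ A 0 1 K :=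
      IsPicardLindelof.of_time_independent (fun x _ => hb x) hK (by simp)
    obtain ⟨α, h0, hα⟩ := hp.exists_eq_forall_mem_Icc_hasDerivWithinAt₀
    refine ⟨α, h0, fun t ht => ?_⟩
    have h1 : a < A := by change a < |a| + 1; linarith [le_abs_self a]
    have h2 : t ∈ Set.Ioo (-A : ℝ) A := ⟨by linarith [ht.1], by linarith [ht.2]⟩
    have h3 : HasDerivAt α (F (α t)) t :=
      (hα t ⟨h2.1.le, h2.2.le⟩).hasDerivAt (Icc_mem_nhds h2.1 h2.2)
    exact (hasMFDerivAt_iff_hasFDerivAt.2 h3.hasFDerivAt).hasMFDerivWithinAt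
  obtain ⟨γ, h0, hγ⟩ := (exists_isMIntegralCurve_iff_exists_isMIntegralCurveOn_Ioo hv x₀).2 hloc
  refine ⟨γ, h0, fun t => ?_⟩
  have : HasFDerivAt γ (ContinuousLinearMap.toSpanSingleton ℝ (F (γ t))) t :=
    hasMFDerivAt_iff_hasFDerivAt.1 (hγ t)
  exact this.hasDerivAt.congr_deriv (by simp)

/-- The line x = 0 is invariant under the planar field, and on it height obeys an autonomous
equation with rest point 1/2. A solution from height 0 cannot pass 1/2 by uniqueness, so the leaf
never leaves the body. Its angle is the integral of `spin`, since `twist` vanishes at x = 0. -/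
theorem hasInfiniteLeaf_vfield : HasInfiniteLeafFromEntry vfield body := by
  have hF : ContDiff ℝ ∞ fun z => damp 0 z := ContDiff.damp contDiff_const contDiff_id
  obtain ⟨f, h0, hf⟩ := exists_global_solution (F := fun z => damp 0 z) (hF.of_le (by simp))
    (fun z => by rw [Real.norm_of_nonneg (damp_nonneg 0 z)]; exact damp_le_one 0 z) 0
  have hcont : Continuous f := continuous_iff_continuousAt.2 fun t => (hf t).continuousAt
  have hmono : Monotone f := monotone_of_deriv_nonneg (fun t => (hf t).differentiableAt)
    fun t => by rw [(hf t).deriv]; exact damp_nonneg _ _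
  have hnn (t : ℝ) (ht : 0 ≤ t) : 0 ≤ f t := h0 ▸ hmono ht
  have hle (t : ℝ) (ht : 0 ≤ t) : f t ≤ 1 / 2 := by
    by_contra! hlt
    have ht0 : 0 < t := ht.lt_of_ne (by rintro rfl; rw [h0] at hlt; norm_num at hlt)
    obtain ⟨s, hs, hs2⟩ := intermediate_value_Ioo ht hcont.continuousOn
      (⟨by rw [h0]; norm_num, hlt⟩ : (1 / 2 : ℝ) ∈ Set.Ioo (f 0) (f t))
    have := planar_const (f := fun t => (0, f t)) (a := 0) (b := t) (R := f t) hs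
      (continuous_const.prodMk hcont).continuousOn
      (fun r _ => ((hasDerivAt_const r (0 : ℝ)).prodMk (hf r)).congr_deriv
        (by simp only [fieldX_zero, fieldZ_zero]))
      (fun r hr => by
        simp only [Prod.norm_def, norm_zero, Real.norm_of_nonneg (hnn r hr.1.le)]
        exact max_le (hnn t ht) (hmono hr.2.le)) (by simp only [hs2]) 0 ⟨le_rfl, ht⟩
    have h1 := congrArg Prod.snd this
    simp only [h0] at h1
    norm_num at h1
  have hspin : Continuous fun t => spin 0 (f t) := by
    have : ContDiff ℝ ∞ fun z => spin 0 z := ContDiff.spin contDiff_const contDiff_id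
    exact this.continuous.comp hcont
  let ψ : ℝ → ℝ := fun t => ∫ r in (0 : ℝ)..t, spin 0 (f r)
  have hψ (t : ℝ) : HasDerivAt ψ (spin 0 (f t)) t :=
    intervalIntegral.integral_hasDerivAt_right (hspin.intervalIntegrable _ _)
      (hspin.stronglyMeasurableAtFilter _ _) hspin.continuousAt
  let γ : ℝ → E3 := fun t => mkPt ((√(3 / 2) : ℝ) * Complex.exp (ψ t * Complex.I)) (f t)
  have hnu (t : ℝ) : nu (γ t) = 3 / 2 := by
    rw [nu_mkPt, norm_mul, Complex.norm_exp_ofReal_mul_I, mul_one, Complex.norm_real,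
      Real.norm_eq_abs, sq_abs, Real.sq_sqrt (by norm_num)]
  have hmem (t : ℝ) (ht : 0 ≤ t) : γ t ∈ body :=
    ⟨by rw [hnu]; norm_num, hnn t ht, (hle t ht).trans (by norm_num)⟩
  refine ⟨γ, ?_, fun t ht => ⟨hmem t ht, ?_⟩⟩
  · rw [entryRegion_eq]
    exact ⟨hmem 0 le_rfl, h0⟩
  · apply HasDerivAt.hasDerivWithinAt
    have h1 : HasDerivAt (fun t : ℝ => (ψ t : ℂ) * Complex.I) (spin 0 (f t) * Complex.I) t :=
      (Complex.ofRealCLM.hasFDerivAt.comp_hasDerivAt t (hψ t)).mul_const Complex.I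
    refine HasDerivAt.congr_deriv (HasDerivAt.mkPt (h1.cexp.const_mul _) (hf t)) ?_
    have hr : rad (γ t) = 0 := by rw [rad, hnu]; norm_num
    refine ext_horiz ?_ ?_
    · rw [horiz_vfield, expand_of_rad_zero hr, speed_of_rad_zero hr]
      simp only [γ, horiz_mkPt, mkPt_two, Complex.ofReal_zero, zero_add]
      ring
    · rw [vfield_two, hr, fieldZ_zero]; rfl

/-! ### Leaves through the plug have matched ends -/

/-- The direction of a point, untwisted about the centre of the square. -/
def phase (q : E3) : ℂ := dir (horiz q) * (starRingEnd ℂ) (dir (offset (nu q) (q 2)))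

/-- Thus ν and `phase` are polar coordinates of the straightened point, and two ends of a leaf match
once both agree. -/
theorem horiz_attachInv (q : E3) : horiz (attachInv q) = nu q * phase q := by
  rw [attachInv, horiz_mkPt, phase]
  conv_lhs => rw [← norm_mul_dir (horiz q)]
  rw [nu_eq]
  have : ‖(‖horiz q‖ : ℂ) * dir (horiz q)‖ = ‖horiz q‖ := by rw [norm_mul_dir]
  rw [this]
  push_cast
  ring

/-- The polar angle turns at the rate `spin + twist` and the direction from A at the rate `twist`;
the difference retains only `spin`. -/
theorem IsTrajectoryOn.phase {γ : ℝ → E3} {J : Set ℝ} {t : ℝ}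
    (h : IsTrajectoryOn vfield body γ J) (ht : t ∈ J) (h0 : offset (nu (γ t)) (γ t 2) ≠ 0) :
    HasDerivWithinAt (fun t => phase (γ t))
      (spin (DehnPlug.rad (γ t)) (γ t 2) * Complex.I * phase (γ t)) J t := by
  have hc0 := horiz_ne_zero_of_nu (body_nu_pos (h t ht).1)
  have h1 := HasDerivWithinAt.dir (h.horiz ht) hc0
  have hoff : HasDerivWithinAt (fun t => offset (nu (γ t)) (γ t 2))
      ⟨fieldX (DehnPlug.rad (γ t)) (γ t 2), fieldZ (DehnPlug.rad (γ t)) (γ t 2)⟩ J t :=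
    Complex.equivRealProdCLM.symm.hasFDerivAt.comp_hasDerivWithinAt t
      ((h.rad ht).prodMk ((h.height ht).sub_const (1 / 2)))
  have h2 := Complex.conjCLE.hasFDerivAt.comp_hasDerivWithinAt t (HasDerivWithinAt.dir hoff h0)
  have e1 : ((starRingEnd ℂ) (DehnPlug.horiz (γ t)) * ((expand (γ t) + speed (γ t) * Complex.I) *
      DehnPlug.horiz (γ t))).im / ‖DehnPlug.horiz (γ t)‖ ^ 2 = speed (γ t) := by
    have : (starRingEnd ℂ) (DehnPlug.horiz (γ t)) * ((expand (γ t) + speed (γ t) * Complex.I) *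
      DehnPlug.horiz (γ t)) = (expand (γ t) + speed (γ t) * Complex.I) *
        ((‖DehnPlug.horiz (γ t)‖ ^ 2 : ℝ) : ℂ) := by
      rw [← Complex.normSq_eq_norm_sq, ← Complex.mul_conj]; ring
    rw [this, Complex.im_mul_ofReal]
    have hn := norm_ne_zero_iff.2 hc0
    simp only [Complex.add_im, Complex.ofReal_im, Complex.im_ofReal_mul, Complex.I_im, mul_one,
      zero_add]
    field_simp
  have e2 : ((starRingEnd ℂ) (offset (nu (γ t)) (γ t 2)) *
      ⟨fieldX (DehnPlug.rad (γ t)) (γ t 2), fieldZ (DehnPlug.rad (γ t)) (γ t 2)⟩).im /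
      ‖offset (nu (γ t)) (γ t 2)‖ ^ 2 = twist (DehnPlug.rad (γ t)) (γ t 2) := by
    have hn : ‖offset (nu (γ t)) (γ t 2)‖ ^ 2 ≠ 0 := pow_ne_zero 2 (norm_ne_zero_iff.2 h0)
    rw [div_eq_iff hn, norm_offset_sq, mul_comm (twist _ _)]
    change _ = (DehnPlug.rad (γ t) ^ 2 + (γ t 2 - 1 / 2) ^ 2) * _
    rw [twist_mul]
    simp [offset, DehnPlug.rad]
    ring
  rw [e1] at h1
  rw [e2] at h2
  refine (h1.mul h2).congr_deriv ?_
  simp only [DehnPlug.phase, Function.comp_apply, ContinuousLinearEquiv.coe_coe,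
    Complex.conjCLE_apply, map_mul, Complex.conj_ofReal, Complex.conj_I, speed]
  push_cast
  ring

theorem reflect_hasDerivWithinAt {E : Type*} [NormedAddCommGroup E] [NormedSpace ℝ E] {f : ℝ → E}
    {f' : E} {a b c t : ℝ} (h : HasDerivWithinAt f f' (Set.Icc a b) (c - t))
    (hab : a + b = c) :
    HasDerivWithinAt (fun t => f (c - t)) (-f') (Set.Icc a b) t := by
  have h1 : HasDerivWithinAt (fun t : ℝ => c - t) (-1) (Set.Icc a b) t :=
    ((hasDerivAt_id t).const_sub c).hasDerivWithinAt
  have := h.scomp t h1 (fun s hs => ⟨by linarith [hs.2], by linarith [hs.1]⟩)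
  exact this.congr_deriv (by simp)

theorem IsTrajectoryOn.mono {V : E3 → E3} {P : Set E3} {γ : ℝ → E3} {J K : Set ℝ}
    (h : IsTrajectoryOn V P γ J) (hK : K ⊆ J) : IsTrajectoryOn V P γ K :=
  fun t ht => ⟨(h t (hK ht)).1, (h t (hK ht)).2.mono hK⟩

/-- The planar projection of a trajectory. -/
def planar (γ : ℝ → E3) (t : ℝ) : ℝ × ℝ := (rad (γ t), γ t 2)

theorem planar_props {γ : ℝ → E3} {a b : ℝ} (h : IsTrajectoryOn vfield body γ (Set.Icc a b)) :
    ContinuousOn (planar γ) (Set.Icc a b) ∧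
    (∀ t ∈ Set.Icc a b, HasDerivWithinAt (planar γ)
      (fieldX (planar γ t).1 (planar γ t).2, fieldZ (planar γ t).1 (planar γ t).2)
      (Set.Icc a b) t) ∧
    (∀ t ∈ Set.Icc a b, |rad (γ t)| ≤ 1 / 2 ∧ 0 ≤ γ t 2 ∧ γ t 2 ≤ 1) := by
  have hd : ∀ t ∈ Set.Icc a b, HasDerivWithinAt (planar γ)
      (fieldX (planar γ t).1 (planar γ t).2, fieldZ (planar γ t).1 (planar γ t).2)
      (Set.Icc a b) t := fun t ht => (h.rad ht).prodMk (h.height ht)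
  refine ⟨fun t ht => (hd t ht).continuousWithinAt, hd, fun t ht => ?_⟩
  obtain ⟨⟨h1, h2⟩, h3⟩ := (h t ht).1
  refine ⟨?_, h3⟩
  rw [abs_le, rad]
  exact ⟨by linarith, by linarith⟩

theorem norm_planar_le {x z : ℝ} (hx : |x| ≤ 1 / 2) (hz : 0 ≤ z ∧ z ≤ 2) : ‖(x, z)‖ ≤ 2 := by
  rw [Prod.norm_def]
  simp only [Real.norm_eq_abs]
  refine max_le (by linarith) ?_
  rw [abs_of_nonneg hz.1]; exact hz.2

/-- The offset vanishes only over A, a rest point of the planar field, and a trajectory through it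
would remain at height 1/2. So `phase` is differentiable along every leaf that crosses the plug. -/
theorem offset_ne_zero_of_crossing {γ : ℝ → E3} {T : ℝ}
    (h : IsTrajectoryOn vfield body γ (Set.Icc 0 T)) (h0 : γ 0 2 = 0) (hT : γ T 2 = 1)
    {t : ℝ} (ht : t ∈ Set.Icc 0 T) : offset (nu (γ t)) (γ t 2) ≠ 0 := by
  intro hoff
  have h1 : rad (γ t) = 0 := congrArg Complex.re hoff
  have h2 : γ t 2 - 1 / 2 = 0 := congrArg Complex.im hoff
  have hz : γ t 2 = 1 / 2 := by linarith
  obtain ⟨hc, hd, hb⟩ := planar_props h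
  have ht' : t ∈ Set.Ioo 0 T := by
    refine ⟨lt_of_le_of_ne ht.1 ?_, lt_of_le_of_ne ht.2 ?_⟩
    · rintro rfl; rw [h0] at hz; norm_num at hz
    · rintro rfl; rw [hT] at hz; norm_num at hz
  have := planar_const ht' hc
    (fun s hs => (hd s ⟨hs.1.le, hs.2.le⟩).hasDerivAt (Icc_mem_nhds hs.1 hs.2))
    (fun s hs => norm_planar_le (hb s ⟨hs.1.le, hs.2.le⟩).1
      ⟨(hb s ⟨hs.1.le, hs.2.le⟩).2.1, (hb s ⟨hs.1.le, hs.2.le⟩).2.2.trans (by norm_num)⟩)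
    (Prod.ext h1 hz) 0 ⟨le_rfl, ht.1.trans ht.2⟩
  have h3 : γ 0 2 = 1 / 2 := congrArg Prod.snd this
  rw [h0] at h3
  norm_num at h3

/-- A trajectory is symmetric about the time at which it crosses height `5/8`. -/
theorem reflection {γ : ℝ → E3} {a b c : ℝ} (h : IsTrajectoryOn vfield body γ (Set.Icc a b))
    (hac : a < c) (hcb : a + b = 2 * c) (hc : γ c 2 = 5 / 8)
    (hoff : ∀ t ∈ Set.Icc a b, offset (nu (γ t)) (γ t 2) ≠ 0) :
    rad (γ b) = rad (γ a) ∧ γ b 2 = 5 / 4 - γ a 2 ∧ phase (γ b) = phase (γ a) := by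
  obtain ⟨hcont, hd, hb⟩ := planar_props h
  have hflip : ∀ t ∈ Set.Icc a b, 2 * c - t ∈ Set.Icc a b := fun t ht =>
    ⟨by linarith [ht.2], by linarith [ht.1]⟩
  -- The mirror image run backwards is again a planar solution, and it meets the original one at
  -- time c because height 5/8 is fixed by the mirror.
  let g : ℝ → ℝ × ℝ := fun t => (rad (γ (2 * c - t)), 5 / 4 - γ (2 * c - t) 2)
  have hg : ∀ t ∈ Set.Icc a b,
      HasDerivWithinAt g (fieldX (g t).1 (g t).2, fieldZ (g t).1 (g t).2) (Set.Icc a b) t := by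
    intro t ht
    have h1 := reflect_hasDerivWithinAt (f := fun t => rad (γ t)) (h.rad (hflip t ht)) hcb
    have h2 := (reflect_hasDerivWithinAt (f := fun t => γ t 2)
      (h.height (hflip t ht)) hcb).const_sub (5 / 4)
    refine (h1.prodMk h2).congr_deriv ?_
    simp only [g, fieldX_reflect, fieldZ_reflect, neg_neg]
  have heq := planar_unique (f := planar γ) (g := g) (a := a) (b := b) (t₀ := c) (R := 2)
    ⟨hac, by linarith⟩ hcont (fun t ht => (hg t ht).continuousWithinAt)
    (fun t ht => (hd t ⟨ht.1.le, ht.2.le⟩).hasDerivAt (Icc_mem_nhds ht.1 ht.2))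
    (fun t ht => (hg t ⟨ht.1.le, ht.2.le⟩).hasDerivAt (Icc_mem_nhds ht.1 ht.2))
    (fun t ht => by
      obtain ⟨h1, h2, h3⟩ := hb t ⟨ht.1.le, ht.2.le⟩
      exact norm_planar_le h1 ⟨h2, by linarith⟩)
    (fun t ht => by
      obtain ⟨h1, h2, h3⟩ := hb _ (hflip t ⟨ht.1.le, ht.2.le⟩)
      exact norm_planar_le h1 ⟨by linarith, by linarith⟩)
    (Prod.ext (by simp [planar, g]; ring_nf) (by
      simp only [planar, g]; rw [show 2 * c - c = c by ring, hc]; norm_num))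
  have hrad : ∀ t ∈ Set.Icc a b, rad (γ t) = rad (γ (2 * c - t)) := fun t ht =>
    congrArg Prod.fst (heq ht)
  have hz : ∀ t ∈ Set.Icc a b, γ t 2 = 5 / 4 - γ (2 * c - t) 2 := fun t ht =>
    congrArg Prod.snd (heq ht)
  have hend : b ∈ Set.Icc a b := ⟨by linarith, le_rfl⟩
  have hba : 2 * c - b = a := by linarith
  refine ⟨by rw [hrad b hend, hba], by rw [hz b hend, hba], ?_⟩
  -- Spins at mirrored times are opposite, so this product is constant. At time c it is 1, and at
  -- time b it compares the phases of the two ends.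
  have hD : ∀ t ∈ Set.Icc a b, HasDerivWithinAt
      (fun t => phase (γ t) * (starRingEnd ℂ) (phase (γ (2 * c - t)))) 0 (Set.Icc a b) t := by
    intro t ht
    have h1 := h.phase ht (hoff t ht)
    have h2 := reflect_hasDerivWithinAt (f := fun t => phase (γ t))
      (h.phase (hflip t ht) (hoff _ (hflip t ht))) hcb
    have h3 := Complex.conjCLE.hasFDerivAt.comp_hasDerivWithinAt t h2
    refine (h1.mul h3).congr_deriv ?_
    have hs : spin (rad (γ t)) (γ t 2) = -spin (rad (γ (2 * c - t))) (γ (2 * c - t) 2) := by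
      rw [hrad t ht, hz t ht, spin_reflect]
    rw [hs]
    simp only [Function.comp_apply, ContinuousLinearEquiv.coe_coe, Complex.conjCLE_apply, map_mul,
      map_neg, Complex.conj_ofReal, Complex.conj_I, Complex.ofReal_neg]
    ring
  have hconst := eq_of_derivWithin_zero hD
  have hunit : ∀ t ∈ Set.Icc a b, phase (γ t) * (starRingEnd ℂ) (phase (γ t)) = 1 := by
    intro t ht
    have h1 := dir_mul_conj (horiz_ne_zero_of_nu (body_nu_pos (h t ht).1))
    have h2 := dir_mul_conj (hoff t ht)
    rw [phase, map_mul, Complex.conj_conj]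
    linear_combination dir (offset (nu (γ t)) (γ t 2)) *
      (starRingEnd ℂ) (dir (offset (nu (γ t)) (γ t 2))) * h1 + h2
  have hcm : c ∈ Set.Icc a b := ⟨hac.le, by linarith⟩
  have h1 := hconst c hcm
  have h2 := hconst b hend
  simp only [show 2 * c - c = c by ring] at h1
  simp only [hba] at h2
  rw [← h1, hunit c hcm] at h2
  have h3 := hunit a ⟨le_rfl, by linarith⟩
  linear_combination phase (γ a) * h2 - phase (γ b) * h3

/-- The part of the leaf above height 5/8 mirrors the part between heights 1/4 and 5/8. Below 1/4
the leaf is in the outer region, where x and `phase` are constant. -/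
theorem crossing_matched {γ : ℝ → E3} {T : ℝ} (hT0 : 0 < T)
    (h : IsTrajectoryOn vfield body γ (Set.Icc 0 T)) (h0 : γ 0 2 = 0) (hT : γ T 2 = 1) :
    rad (γ 0) = rad (γ T) ∧ phase (γ 0) = phase (γ T) := by
  obtain ⟨-, hd, hb⟩ := planar_props h
  have hoff : ∀ t ∈ Set.Icc 0 T, offset (nu (γ t)) (γ t 2) ≠ 0 := fun t ht =>
    offset_ne_zero_of_crossing h h0 hT ht
  have hzc : ContinuousOn (fun t => γ t 2) (Set.Icc 0 T) := fun t ht =>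
    (h.height ht).continuousWithinAt
  obtain ⟨c, ⟨hc0, hcT⟩, hc⟩ := intermediate_value_Ioo hT0.le hzc
    (⟨by rw [h0]; norm_num, by rw [hT]; norm_num⟩ : (5 / 8 : ℝ) ∈ Set.Ioo (γ 0 2) (γ T 2))
  -- Otherwise the mirror image of the starting point, at height 5/4, would lie on the leaf, above
  -- the body.
  have hlt : T < 2 * c := by
    by_contra! hle
    have hsub : Set.Icc 0 (2 * c) ⊆ Set.Icc 0 T := Set.Icc_subset_Icc_right hle
    have := (reflection (h.mono hsub) hc0 (by ring) hc fun t ht => hoff t (hsub ht)).2.1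
    rw [h0] at this
    have := (hb (2 * c) ⟨by linarith, hle⟩).2.2
    linarith
  have hsub : Set.Icc (2 * c - T) T ⊆ Set.Icc 0 T := Set.Icc_subset_Icc_left (by linarith)
  obtain ⟨h1, h2, h3⟩ := reflection (h.mono hsub) (by linarith) (by ring) hc
    fun t ht => hoff t (hsub ht)
  rw [hT] at h2
  have hsub' : Set.Icc 0 (2 * c - T) ⊆ Set.Icc 0 T := Set.Icc_subset_Icc_right (by linarith)
  have h' := h.mono hsub'
  have hend : 2 * c - T ∈ Set.Icc 0 (2 * c - T) := ⟨by linarith, le_rfl⟩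
  have hout : ∀ t ∈ Set.Icc 0 (2 * c - T), IsOuter (rad (γ t)) (γ t 2) := by
    intro t ht
    apply isOuter_of_le
    have : γ t 2 ≤ γ (2 * c - T) 2 := height_monotoneOn h' ht hend ht.2
    linarith
  have e1 := eq_of_derivWithin_zero (f := fun t => rad (γ t))
    (fun t ht => (h'.rad ht).congr_deriv (hout t ht).fieldX) _ hend
  have e2 := eq_of_derivWithin_zero (f := fun t => phase (γ t))
    (fun t ht => (h'.phase ht (hoff t (hsub' ht))).congr_deriv
      (by rw [(hout t ht).spin]; simp)) _ hend
  exact ⟨by rw [h1, ← e1], by rw [h3, ← e2]⟩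

theorem hasMatchedEnds_vfield : HasMatchedEnds vfield body annulus entryMap exitMap where
  smooth_entry := fun _ hx => (contDiffAt_face (Or.inl rfl) hx).contDiffWithinAt
  smooth_exit := fun _ hx => (contDiffAt_face (Or.inr rfl) hx).contDiffWithinAt
  immersion_entry := fun _ hx => injective_face (Or.inl rfl) hx
  immersion_exit := fun _ hx => injective_face (Or.inr rfl) hx
  bij_entry := by rw [entryRegion_eq]; exact bijOn_face (Or.inl rfl)
  bij_exit := by rw [exitRegion_eq]; exact bijOn_face (Or.inr rfl)
  matched := by
    rintro x hx y hy ⟨T, γ, hT0, htraj, h0, hT⟩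
    obtain ⟨h1, h2⟩ := crossing_matched hT0 htraj (by rw [h0]; rfl) (by rw [hT]; rfl)
    rw [h0, hT] at h1 h2
    have h3 : horiz (attachInv (entryMap y)) = horiz (attachInv (exitMap x)) := by
      have : nu (entryMap y) = nu (exitMap x) := by unfold rad at h1; linarith
      rw [horiz_attachInv, horiz_attachInv, h2, this]
    rw [entryMap, exitMap,
      attachInv_attachFun (offset_ne_zero (lift_mem_attachSource hy (Or.inl rfl)).2),
      attachInv_attachFun (offset_ne_zero (lift_mem_attachSource hx (Or.inr rfl)).2)] at h3
    have h4 : toC y = toC x := h3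
    rw [← ofC_toC x, ← h4, ofC_toC]

theorem isPlug_vfield : IsPlug vfield body annulus entryMap exitMap :=
  ⟨isFlowBordism_vfield, hasInfiniteLeaf_vfield, hasMatchedEnds_vfield⟩

end DehnPlug

end

theorem mainTheorem3 :
    ∃ (P : Set DehnPlug.E3) (V : DehnPlug.E3 → DehnPlug.E3)
      (a b : DehnPlug.E2 → DehnPlug.E3),
      DehnPlug.IsPlug V P DehnPlug.annulus a b ∧
      DehnPlug.IsMeasured V P ∧
      DehnPlug.IsIntegrallyDehnTwisted V P a b ∧
      {L : Set DehnPlug.E3 | DehnPlug.IsClosedLeaf V P L}.ncard = 2 :=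
  ⟨DehnPlug.body, DehnPlug.vfield, DehnPlug.entryMap, DehnPlug.exitMap, DehnPlug.isPlug_vfield,
    DehnPlug.isMeasured_vfield, DehnPlug.isIntegrallyDehnTwisted_vfield,
    DehnPlug.ncard_closedLeaves⟩
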